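/- Let $\mathbb E^5_1$ be Minkowski 5-space, i.e. $\mathbb R^5$ with the metric $\langle\ ,\ \rangle=-dx_1^2+dx_2^2+dx_3^2+dx_4^2+dx_5^2$. Let $x:M\to\mathbb E^5_1$ be a smooth immersion of a 4-dimensional smooth manifold whose induced metric is Lorentzian (signature $(-,+,+,+)$). For a local unit normal field $N$, the shape operator $S$ is defined by $dx(SX)=-dN(X)$. Suppose that every point of $M$ has a neighbourhood carrying a smooth unit normal field $N$, a smooth frame field $e_1,e_2,e_3,e_4$ that is pseudo-orthonormal, i.e. $$\langle e_1,e_1\rangle=\langle e_2,e_2\rangle=0,\quad \langle e_1,e_2\rangle=-1,\quad \langle e_A,e_a\rangle=0,\quad \langle e_a,e_b\rangle=\delta_{ab}\qquad (A=1,2;\ a,b=3,4),$$ and smooth functions $k_1,k_4$ such that $$Se_1=k_1e_1-e_3,\quad Se_2=k_1e_2,\quad Se_3=e_2+k_1e_3,\quad Se_4=k_4e_4$$ (so $S$ is non-diagonalizable, with characteristic polynomial $(t-k_1)^3(t-k_4)$; $k_1=k_4$ is allowed). Then $M$ is biharmonic, i.e. $\Delta^2x=0$ componentwise for the Laplace operator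 $\Delta$ of the induced metric, if and only if $M$ is minimal, i.e. $\operatorname{tr}S=0$ on $M$. -/

import Mathlib

open scoped Manifold ContDiff

namespace LorentzHypersurface

/-- The vector space underlying Minkowski 5-space; its norm is only used for the topology. -/
abbrev E51 : Type := Fin 5 → ℝ

/-- The model space of a 4-dimensional manifold. -/
abbrev R4 : Type := EuclideanSpace ℝ (Fin 4)

/-- The metric `-dx₁² + dx₂² + dx₃² + dx₄² + dx₅²` of Minkowski 5-space. -/
def mink (v w : E51) : ℝ := -(v 0 * w 0) + ∑ i : Fin 4, v i.succ * w i.succ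

/-! ### The Laplace operator in local coordinates -/

/-- The partial derivative `∂ᵢ u`. -/
noncomputable def pd (i : Fin 4) (u : R4 → ℝ) (y : R4) : ℝ :=
  fderiv ℝ u y (EuclideanSpace.single i 1)

/-- The matrix `gᵢⱼ = ⟨∂ᵢF, ∂ⱼF⟩` of the metric induced by a parametrization `F`. -/
noncomputable def inducedMetric (F : R4 → E51) (y : R4) : Matrix (Fin 4) (Fin 4) ℝ :=
  Matrix.of fun i j =>
    mink (fderiv ℝ F y (EuclideanSpace.single i 1)) (fderiv ℝ F y (EuclideanSpace.single j 1))

/-- The Christoffel symbols `Γᵏᵢⱼ` of the Levi-Civita connection of the metric `g`. -/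
noncomputable def christoffel (g : R4 → Matrix (Fin 4) (Fin 4) ℝ) (k i j : Fin 4) (y : R4) : ℝ :=
  (1 / 2) * ∑ l, (g y)⁻¹ k l *
    (pd i (fun z => g z j l) y + pd j (fun z => g z i l) y - pd l (fun z => g z i j) y)

/-- The Laplace operator of the metric `g`, with the sign `Δ = -tr_g Hess`. -/
noncomputable def laplacian (g : R4 → Matrix (Fin 4) (Fin 4) ℝ) (u : R4 → ℝ) (y : R4) : ℝ :=
  -∑ i, ∑ j, (g y)⁻¹ i j * (pd i (pd j u) y - ∑ k, christoffel g k i j y * pd k u y)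

variable {M : Type*} [TopologicalSpace M] [ChartedSpace R4 M]

/-- The induced metric `⟨v, w⟩` on the tangent space at `p`. -/
noncomputable def firstForm (x : M → E51) (p : M) (v w : TangentSpace (𝓡 4) p) : ℝ :=
  mink (mfderiv (𝓡 4) 𝓘(ℝ, E51) x p v) (mfderiv (𝓡 4) 𝓘(ℝ, E51) x p w)

/-- `x` is a smooth immersion whose induced metric has signature `(-,+,+,+)` at every point. -/
structure IsLorentzianHypersurface (x : M → E51) : Prop where
  smooth : ContMDiff (𝓡 4) 𝓘(ℝ, E51) ∞ x
  immersion : ∀ p, Function.Injective (mfderiv (𝓡 4) 𝓘(ℝ, E51) x p)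
  lorentzian : ∀ p, ∃ b : Module.Basis (Fin 4) ℝ (TangentSpace (𝓡 4) p), ∀ i j,
    firstForm x p (b i) (b j) = if i = j then (if i = 0 then -1 else 1) else 0

/-- `Δ² x = 0`, where `Δ` is the Laplace operator of the induced metric: in the coordinates given
by any chart, every component of the position vector is annihilated by `Δ²`. -/
def IsBiharmonic (x : M → E51) : Prop :=
  ∀ φ ∈ atlas R4 M, ∀ y ∈ φ.target, ∀ a : Fin 5,
    laplacian (inducedMetric (x ∘ φ.symm))
      (laplacian (inducedMetric (x ∘ φ.symm)) (fun z => x (φ.symm z) a)) y = 0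

/-- `N` is a smooth unit normal field of `x` on the set `U`. -/
structure IsUnitNormalOn (x N : M → E51) (U : Set M) : Prop where
  smooth : ContMDiffOn (𝓡 4) 𝓘(ℝ, E51) ∞ N U
  unit : ∀ p ∈ U, mink (N p) (N p) = 1
  normal : ∀ p ∈ U, ∀ v : TangentSpace (𝓡 4) p,
    mink (mfderiv (𝓡 4) 𝓘(ℝ, E51) x p v) (N p) = 0

/-- The shape operator `S` at `p` for the unit normal field `N`: the endomorphism of the tangent
space with `dx (S v) = -dN v`. It is obtained from `-dN`, whose values are tangent to `x`, by a
left inverse of the injective map `dx`. -/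
noncomputable def shapeOperator (x N : M → E51) (p : M) :
    TangentSpace (𝓡 4) p →ₗ[ℝ] TangentSpace (𝓡 4) p :=
  let dx : TangentSpace (𝓡 4) p →ₗ[ℝ] E51 := (mfderiv (𝓡 4) 𝓘(ℝ, E51) x p).toLinearMap
  let dN : TangentSpace (𝓡 4) p →ₗ[ℝ] E51 := (mfderiv (𝓡 4) 𝓘(ℝ, E51) N p).toLinearMap
  dx.leftInverse ∘ₗ (-dN)

/-- The mean curvature `tr S` vanishes at every point. Local unit normal fields are unique up to
sign, which does not affect the vanishing of `tr S`; no global orientation is needed. -/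
def IsMinimal (x : M → E51) : Prop :=
  ∀ p : M, ∃ (U : Set M) (N : M → E51), IsOpen U ∧ p ∈ U ∧ IsUnitNormalOn x N U ∧
    LinearMap.trace ℝ (TangentSpace (𝓡 4) p) (shapeOperator x N p) = 0

/-- The Gram matrix of a pseudo-orthonormal frame `e₁, e₂, e₃, e₄`: `e₁, e₂` are light-like with
`⟨e₁, e₂⟩ = -1`, and `e₃, e₄` are orthonormal and orthogonal to `e₁, e₂`. -/
def pseudoOrthonormalGram : Matrix (Fin 4) (Fin 4) ℝ :=
  !![0, -1, 0, 0;
     -1, 0, 0, 0;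
     0, 0, 1, 0;
     0, 0, 0, 1]

/-- `e` is a smooth pseudo-orthonormal frame field on `U`. (The Gram matrix being invertible, the
four vectors are a basis of the tangent space at each point of `U`.) -/
structure IsPseudoOrthonormalFrameOn [IsManifold (𝓡 4) ∞ M] (x : M → E51)
    (e : Fin 4 → (p : M) → TangentSpace (𝓡 4) p) (U : Set M) : Prop where
  smooth : ∀ i, ContMDiffOn (𝓡 4) (𝓡 4).tangent ∞
    (fun p => (⟨p, e i p⟩ : TangentBundle (𝓡 4) M)) U
  gram : ∀ p ∈ U, ∀ i j, firstForm x p (e i p) (e j p) = pseudoOrthonormalGram i j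

/-- Near every point there are a smooth unit normal field, a smooth pseudo-orthonormal frame field
and smooth functions `k₁, k₄` with
`S e₁ = k₁ e₁ - e₃`, `S e₂ = k₁ e₂`, `S e₃ = e₂ + k₁ e₃`, `S e₄ = k₄ e₄`. -/
def HasCaseIIShapeOperator [IsManifold (𝓡 4) ∞ M] (x : M → E51) : Prop :=
  ∀ p₀ : M, ∃ (U : Set M) (N : M → E51) (e : Fin 4 → (p : M) → TangentSpace (𝓡 4) p)
    (k₁ k₄ : M → ℝ),
    IsOpen U ∧ p₀ ∈ U ∧ IsUnitNormalOn x N U ∧ IsPseudoOrthonormalFrameOn x e U ∧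
    ContMDiffOn (𝓡 4) 𝓘(ℝ, ℝ) ∞ k₁ U ∧ ContMDiffOn (𝓡 4) 𝓘(ℝ, ℝ) ∞ k₄ U ∧
    ∀ p ∈ U,
      shapeOperator x N p (e 0 p) = k₁ p • e 0 p - e 2 p ∧
      shapeOperator x N p (e 1 p) = k₁ p • e 1 p ∧
      shapeOperator x N p (e 2 p) = e 1 p + k₁ p • e 2 p ∧
      shapeOperator x N p (e 3 p) = k₄ p • e 3 p

end LorentzHypersurface

namespace LorentzHypersurface

-- Write f = 3k₁ + k₄ for tr S, L for the trace of the Hessian, and number the frame e₀, …, e₃ as in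
-- the code. Beltrami's formula L x = f N (`laplacian_F`) reduces the claim to: L(fN) = 0 forces f =
-- 0. The product rule and the contracted Codazzi equation split L(fN) = 0 into a normal part L f =
-- f (3k₁² + k₄²) and a tangential part 2 S∇f + f∇f = 0 (`frameLaplacian_shapeTrace`,
-- `gradient_system`). It suffices that ∇f = 0 wherever f ≠ 0: then L f = 0 there, so k₁ = k₄ = 0
-- and f = 0 after all.
--
-- Where neither f nor ∇f vanishes, ∇f is an eigenvector of S for -f/2. If -f/2 = k₁, then k₄ = -5k₁
-- and ∇f is a multiple of the light-like e₁; Codazzi makes f harmonic, against the normal part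
-- (`frameLaplacian_eq_zero_of_lightlike`). Otherwise -f/2 = k₄ = -k₁ and ∇f is a multiple of e₃.
-- With ω = ⟨∇_{e₁}e₃, e₀⟩, Codazzi gives e₃f = 4k₁ω and L f = e₃e₃f - 3ω e₃f, and Gauss gives e₃ω =
-- ω² - k₁². Hence L f = -4k₁³, while the normal part demands 8k₁³, so k₁ = 0
-- (`k₁_eq_zero_of_spacelike`).
--
-- The connection is the tangential part of the flat derivative of `E51`. Gauss and Codazzi are thus
-- components of commutators of derivatives of `E51`-valued functions in a chart.

local notation "η" => pseudoOrthonormalGram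

/-! ### Linear algebra of the Minkowski product -/

theorem mink_comm (v w : E51) : mink v w = mink w v := by
  simp only [mink, mul_comm]

theorem mink_add_left (u v w : E51) : mink (u + v) w = mink u w + mink v w := by
  simp only [mink, Pi.add_apply, add_mul, Finset.sum_add_distrib]; ring

theorem mink_smul_left (c : ℝ) (v w : E51) : mink (c • v) w = c * mink v w := by
  simp only [mink, Pi.smul_apply, smul_eq_mul, mul_add, Finset.mul_sum, mul_assoc]; ring

/-- The Minkowski product as a continuous bilinear map. -/
noncomputable def minkL : E51 →L[ℝ] E51 →L[ℝ] ℝ :=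
  LinearMap.toContinuousBilinearMap (LinearMap.mk₂ ℝ mink mink_add_left mink_smul_left
    (fun u v w => by simp only [mink_comm u, mink_add_left])
    (fun c v w => by simp only [mink_comm v, mink_smul_left]; rfl))

theorem minkL_apply (v w : E51) : minkL v w = mink v w := rfl

theorem mink_zero_left (w : E51) : mink 0 w = 0 := by
  simp [mink]

theorem mink_add_right (u v w : E51) : mink u (v + w) = mink u v + mink u w := by
  simp only [← minkL_apply, map_add]

theorem mink_smul_right (c : ℝ) (v w : E51) : mink v (c • w) = c * mink v w := by
  simp only [← minkL_apply, map_smul, smul_eq_mul]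

theorem mink_sub_left (u v w : E51) : mink (u - v) w = mink u w - mink v w := by
  simp only [← minkL_apply, map_sub, _root_.sub_apply]

theorem mink_neg_left (v w : E51) : mink (-v) w = -mink v w := by
  simp only [← minkL_apply, map_neg, _root_.neg_apply]

theorem mink_neg_right (v w : E51) : mink v (-w) = -mink v w := by
  simp only [← minkL_apply, map_neg]

theorem mink_sum_left {ι : Type*} (s : Finset ι) (u : ι → E51) (w : E51) :
    mink (∑ i ∈ s, u i) w = ∑ i ∈ s, mink (u i) w := by
  simp only [← minkL_apply, map_sum, _root_.sum_apply]

theorem mink_sum_right {ι : Type*} (s : Finset ι) (u : ι → E51) (w : E51) :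
    mink w (∑ i ∈ s, u i) = ∑ i ∈ s, mink w (u i) := by
  simp only [← minkL_apply, map_sum]

/-- As η is its own inverse, it also raises indices: the factors `η c d` in the expansions below are
entries of the inverse Gram matrix. -/
theorem gram_mul_gram : η * η = 1 := by
  ext i j
  fin_cases i <;> fin_cases j <;>
    simp [pseudoOrthonormalGram, Matrix.mul_apply, Fin.sum_univ_four]

theorem gram_symm (i j : Fin 4) : η i j = η j i := by
  fin_cases i <;> fin_cases j <;> simp [pseudoOrthonormalGram]

/-- A vector orthogonal to a pseudo-orthonormal frame and to its unit normal vanishes. -/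
theorem eq_zero_of_mink_eq_zero {E : Fin 4 → E51} {n : E51}
    (hE : ∀ i j, mink (E i) (E j) = η i j) (hEn : ∀ i, mink (E i) n = 0) (hn : mink n n = 1)
    {v : E51} (hv : ∀ i, mink v (E i) = 0) (hvn : mink v n = 0) : v = 0 := by
  have hli : LinearIndependent ℝ (Fin.cons n E : Fin 5 → E51) := by
    rw [Fintype.linearIndependent_iff]
    intro c hc
    rw [Fin.sum_univ_succ] at hc
    simp only [Fin.cons_zero, Fin.cons_succ] at hc
    have h0 : c 0 = 0 := by
      have := congrArg (fun z => mink z n) hc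
      simpa [mink_add_left, mink_sum_left, mink_smul_left, hn, hEn, mink_zero_left] using this
    have h1 : ∀ j, ∑ i : Fin 4, c i.succ * η i j = 0 := by
      intro j
      have := congrArg (fun z => mink z (E j)) hc
      simp only [mink_add_left, mink_sum_left, mink_smul_left, h0, hE] at this
      simpa [mink_zero_left] using this
    intro i
    refine Fin.cases h0 (fun i => ?_) i
    have h0' := h1 0
    have h1' := h1 1
    have h2' := h1 2
    have h3' := h1 3
    simp [Fin.sum_univ_four, pseudoOrthonormalGram] at h0' h1' h2' h3'
    fin_cases i <;> simp_all
  have hspan := hli.span_eq_top_of_card_eq_finrank (by simp)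
  -- The normal and the frame form a basis, so v is orthogonal to everything; testing on the
  -- standard basis then gives v = 0.
  have hzero : minkL v = 0 := by
    have : (minkL v).toLinearMap = 0 := by
      apply LinearMap.ext_on_range hspan
      intro i
      refine Fin.cases ?_ (fun i => ?_) i
      · simpa [minkL_apply] using hvn
      · simpa [minkL_apply] using hv i
    ext1 w
    exact congrArg (fun l => l w) this
  have h : ∀ w, mink v w = 0 := fun w => by rw [← minkL_apply, hzero]; rfl
  ext i
  have := h (Pi.single i 1)
  fin_cases i <;> simpa [mink, Fin.sum_univ_four, Pi.single_apply] using this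

/-- Expansion of a vector in a pseudo-orthonormal frame and its unit normal. -/
theorem frame_expansion {E : Fin 4 → E51} {n : E51}
    (hE : ∀ i j, mink (E i) (E j) = η i j) (hEn : ∀ i, mink (E i) n = 0) (hn : mink n n = 1)
    (v : E51) : v = ∑ c, ∑ d, (η c d * mink v (E d)) • E c + mink v n • n := by
  rw [← sub_eq_zero]
  apply eq_zero_of_mink_eq_zero hE hEn hn
  · intro i
    simp only [mink_sub_left, mink_add_left, mink_sum_left, mink_smul_left, hE, mink_comm n, hEn]
    fin_cases i <;> simp [Fin.sum_univ_four, pseudoOrthonormalGram]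
  · simp only [mink_sub_left, mink_add_left, mink_sum_left, mink_smul_left, hEn, hn]
    simp

theorem mink_expansion {E : Fin 4 → E51} {n : E51}
    (hE : ∀ i j, mink (E i) (E j) = η i j) (hEn : ∀ i, mink (E i) n = 0) (hn : mink n n = 1)
    (u v : E51) :
    mink u v = ∑ c, ∑ d, η c d * mink u (E c) * mink v (E d) + mink u n * mink v n := by
  conv_lhs => rw [frame_expansion hE hEn hn v]
  simp only [mink_add_right, mink_sum_right, mink_smul_right]
  rw [mul_comm (mink v n)]
  congr 1
  refine Finset.sum_congr rfl fun c _ => Finset.sum_congr rfl fun d _ => by ring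

section FrameBasis

variable {V : Type*} [AddCommGroup V] [Module ℝ V] {L : V →ₗ[ℝ] E51} {e : Fin 4 → V}

theorem linearIndependent_of_gram (h : ∀ i j, mink (L (e i)) (L (e j)) = η i j) :
    LinearIndependent ℝ e := by
  rw [Fintype.linearIndependent_iff]
  intro c hc
  have h1 : ∀ j, ∑ i : Fin 4, c i * η i j = 0 := by
    intro j
    have := congrArg (fun z => mink (L z) (L (e j))) hc
    simp only [map_sum, map_smul, mink_sum_left, mink_smul_left, h] at this
    simpa [← minkL_apply] using this
  have h0' := h1 0
  have h1' := h1 1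
  have h2' := h1 2
  have h3' := h1 3
  simp [Fin.sum_univ_four, pseudoOrthonormalGram] at h0' h1' h2' h3'
  intro i
  fin_cases i <;> simp_all

/-- A pseudo-orthonormal family of four vectors, as a basis. -/
noncomputable def gramBasis (hV : Module.finrank ℝ V = 4)
    (h : ∀ i j, mink (L (e i)) (L (e j)) = η i j) : Module.Basis (Fin 4) ℝ V :=
  basisOfLinearIndependentOfCardEqFinrank (linearIndependent_of_gram h) (by simp [hV])

theorem gramBasis_apply (hV : Module.finrank ℝ V = 4)
    (h : ∀ i j, mink (L (e i)) (L (e j)) = η i j) (i : Fin 4) : gramBasis hV h i = e i := by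
  simp [gramBasis]

theorem gramBasis_repr (hV : Module.finrank ℝ V = 4)
    (h : ∀ i j, mink (L (e i)) (L (e j)) = η i j) (v : V) (c : Fin 4) :
    (gramBasis hV h).repr v c = ∑ d, η c d * mink (L v) (L (e d)) := by
  conv_rhs => rw [← (gramBasis hV h).sum_repr v]
  simp only [gramBasis_apply, map_sum, map_smul, mink_sum_left, mink_smul_left, h]
  fin_cases c <;> simp [Fin.sum_univ_four, pseudoOrthonormalGram]

theorem vector_expansion (hV : Module.finrank ℝ V = 4)
    (h : ∀ i j, mink (L (e i)) (L (e j)) = η i j) (v : V) :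
    v = ∑ c, (∑ d, η c d * mink (L v) (L (e d))) • e c := by
  conv_lhs => rw [← (gramBasis hV h).sum_repr v]
  simp only [gramBasis_apply, gramBasis_repr]

theorem trace_eq_sum_gram (hV : Module.finrank ℝ V = 4)
    (h : ∀ i j, mink (L (e i)) (L (e j)) = η i j) (T : V →ₗ[ℝ] V) :
    LinearMap.trace ℝ V T = ∑ a, ∑ b, η a b * mink (L (T (e a))) (L (e b)) := by
  rw [LinearMap.trace_eq_matrix_trace ℝ (gramBasis hV h) T, Matrix.trace]
  refine Finset.sum_congr rfl fun a _ => ?_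
  rw [Matrix.diag_apply, LinearMap.toMatrix_apply, gramBasis_repr, gramBasis_apply]

end FrameBasis

/-- Contraction with the inverse of the induced metric, computed in a pseudo-orthonormal frame. -/
theorem sum_inv_metric_eq {L : R4 →L[ℝ] E51} {e : Fin 4 → R4}
    (h : ∀ i j, mink (L (e i)) (L (e j)) = η i j) {g : Matrix (Fin 4) (Fin 4) ℝ}
    (hg : ∀ i j, g i j = mink (L (EuclideanSpace.single i 1)) (L (EuclideanSpace.single j 1)))
    (B : R4 →ₗ[ℝ] R4 →ₗ[ℝ] ℝ) :
    ∑ i, ∑ j, g⁻¹ i j * B (EuclideanSpace.single i 1) (EuclideanSpace.single j 1) =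
      ∑ a, ∑ b, η a b * B (e a) (e b) := by
  have hexp : ∀ v : R4, v = ∑ i, v i • EuclideanSpace.single i (1 : ℝ) := by
    intro v
    ext j
    simp [Finset.sum_apply, Pi.single_apply]
  set P : Matrix (Fin 4) (Fin 4) ℝ := Matrix.of fun i a => e a i with hP
  have hPg : P.transpose * g * P = η := by
    ext a b
    rw [← h a b, hexp (e a), hexp (e b)]
    simp only [map_sum, map_smul, mink_sum_left, mink_smul_left, mink_sum_right, mink_smul_right,
      Matrix.mul_apply, Matrix.transpose_apply, hg, hP, Matrix.of_apply, Finset.sum_mul,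
      Finset.mul_sum]
    refine Finset.sum_congr rfl fun i _ => Finset.sum_congr rfl fun j _ => by ring
  have hinv : g⁻¹ = P * η * P.transpose := by
    apply Matrix.inv_eq_right_inv
    -- From Pᵀ g P = η and η² = 1, Pᵀ is a left inverse of g P η; for square matrices it is also a
    -- right inverse.
    have : P.transpose * (g * P * η) = 1 := by
      rw [← gram_mul_gram, ← hPg]
      simp only [Matrix.mul_assoc]
    rw [mul_eq_one_comm] at this
    simpa only [Matrix.mul_assoc] using this
  rw [hinv]
  have hR : ∀ a b, B (e a) (e b) = ∑ i, ∑ j, e a i * e b j *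
      B (EuclideanSpace.single i 1) (EuclideanSpace.single j 1) := by
    intro a b
    conv_lhs => rw [hexp (e a), hexp (e b)]
    simp only [map_sum, map_smul, LinearMap.sum_apply, LinearMap.smul_apply, smul_eq_mul,
      Finset.mul_sum]
    rw [Finset.sum_comm]
    refine Finset.sum_congr rfl fun i _ => Finset.sum_congr rfl fun j _ => by ring
  simp only [hR, Matrix.mul_apply, Matrix.transpose_apply, hP, Matrix.of_apply, Fin.sum_univ_four]
  ring

/-! ### Directional derivatives along vector fields -/

section Calculus

variable {V : Type*} [NormedAddCommGroup V] [NormedSpace ℝ V]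

/-- The derivative of `u` along the vector field `X`. -/
noncomputable def dirD (X : R4 → R4) (u : R4 → V) (y : R4) : V := fderiv ℝ u y (X y)

variable {W : Set R4} {X Y : R4 → R4} {u v : R4 → V} {y : R4}

theorem contDiffOn_dirD (hW : IsOpen W) (hX : ContDiffOn ℝ ∞ X W) (hu : ContDiffOn ℝ ∞ u W) :
    ContDiffOn ℝ ∞ (dirD X u) W :=
  (hu.fderiv_of_isOpen hW (by simp)).clm_apply hX

theorem differentiableAt_of_contDiffOn (hW : IsOpen W) (hu : ContDiffOn ℝ ∞ u W) (hy : y ∈ W) :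
    DifferentiableAt ℝ u y :=
  (hu.contDiffAt (hW.mem_nhds hy)).differentiableAt (by simp)

theorem dirD_congr (hW : IsOpen W) (h : ∀ z ∈ W, u z = v z) (hy : y ∈ W) :
    dirD X u y = dirD X v y := by
  have : u =ᶠ[nhds y] v := Filter.eventually_of_mem (hW.mem_nhds hy) h
  rw [dirD, dirD, this.fderiv_eq]

theorem dirD_eq_zero_of_const (hW : IsOpen W) {c : V} (h : ∀ z ∈ W, u z = c) (hy : y ∈ W) :
    dirD X u y = 0 := by
  rw [dirD_congr (v := fun _ => c) hW h hy, dirD]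
  simp

theorem dirD_dirD (hW : IsOpen W) (hY : ContDiffOn ℝ ∞ Y W) (hu : ContDiffOn ℝ ∞ u W)
    (hy : y ∈ W) :
    dirD X (dirD Y u) y =
      fderiv ℝ (fderiv ℝ u) y (X y) (Y y) + fderiv ℝ u y (fderiv ℝ Y y (X y)) := by
  have h1 : DifferentiableAt ℝ (fderiv ℝ u) y :=
    differentiableAt_of_contDiffOn hW (hu.fderiv_of_isOpen hW (by simp)) hy
  have h2 := differentiableAt_of_contDiffOn hW hY hy
  have : fderiv ℝ (dirD Y u) y = _ := fderiv_clm_apply h1 h2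
  rw [dirD, this]
  simp [add_comm]

theorem snd_fderiv_symm (hW : IsOpen W) (hu : ContDiffOn ℝ ∞ u W) (hy : y ∈ W) (a b : R4) :
    fderiv ℝ (fderiv ℝ u) y a b = fderiv ℝ (fderiv ℝ u) y b a :=
  (hu.contDiffAt (hW.mem_nhds hy)).isSymmSndFDerivAt
    (by simpa using WithTop.coe_le_coe.2 (le_top : (2 : ℕ∞) ≤ ⊤)) a b

/-- The second derivatives of u cancel by symmetry; what remains is the derivative of u along the
Lie bracket of X and Y. -/
theorem dirD_commutator (hW : IsOpen W) (hX : ContDiffOn ℝ ∞ X W) (hY : ContDiffOn ℝ ∞ Y W)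
    (hu : ContDiffOn ℝ ∞ u W) (hy : y ∈ W) :
    dirD X (dirD Y u) y - dirD Y (dirD X u) y =
      fderiv ℝ u y (fderiv ℝ Y y (X y) - fderiv ℝ X y (Y y)) := by
  rw [dirD_dirD hW hY hu hy, dirD_dirD hW hX hu hy, snd_fderiv_symm hW hu hy, map_sub]
  abel

theorem fderiv_mink {f g : R4 → E51} (hf : DifferentiableAt ℝ f y) (hg : DifferentiableAt ℝ g y)
    (a : R4) : fderiv ℝ (fun z => mink (f z) (g z)) y a =
      mink (fderiv ℝ f y a) (g y) + mink (f y) (fderiv ℝ g y a) := by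
  have := (minkL.hasFDerivAt_of_bilinear hf.hasFDerivAt hg.hasFDerivAt).fderiv
  simp only [minkL_apply] at this
  rw [this]
  simp [minkL_apply, add_comm]

theorem dirD_mink {f g : R4 → E51} (hW : IsOpen W) (hf : ContDiffOn ℝ ∞ f W)
    (hg : ContDiffOn ℝ ∞ g W) (hy : y ∈ W) :
    dirD X (fun z => mink (f z) (g z)) y = mink (dirD X f y) (g y) + mink (f y) (dirD X g y) :=
  fderiv_mink (differentiableAt_of_contDiffOn hW hf hy) (differentiableAt_of_contDiffOn hW hg hy) _

theorem contDiffOn_mink {f g : R4 → E51} (hf : ContDiffOn ℝ ∞ f W) (hg : ContDiffOn ℝ ∞ g W) :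
    ContDiffOn ℝ ∞ (fun z => mink (f z) (g z)) W := by
  have h : ContDiffOn ℝ ∞ (fun z => minkL (f z) (g z)) W :=
    (minkL.contDiff.comp_contDiffOn hf).clm_apply hg
  exact h

theorem dirD_smul {f : R4 → ℝ} (hW : IsOpen W) (hf : ContDiffOn ℝ ∞ f W)
    (hu : ContDiffOn ℝ ∞ u W) (hy : y ∈ W) :
    dirD X (fun z => f z • u z) y = dirD X f y • u y + f y • dirD X u y := by
  rw [dirD, fderiv_fun_smul (differentiableAt_of_contDiffOn hW hf hy)
    (differentiableAt_of_contDiffOn hW hu hy)]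
  simp [dirD, add_comm]

theorem dirD_mul {f g : R4 → ℝ} (hW : IsOpen W) (hf : ContDiffOn ℝ ∞ f W)
    (hg : ContDiffOn ℝ ∞ g W) (hy : y ∈ W) :
    dirD X (fun z => f z * g z) y = dirD X f y * g y + f y * dirD X g y :=
  dirD_smul hW hf hg hy

theorem dirD_add (hW : IsOpen W) (hu : ContDiffOn ℝ ∞ u W) (hv : ContDiffOn ℝ ∞ v W)
    (hy : y ∈ W) : dirD X (fun z => u z + v z) y = dirD X u y + dirD X v y := by
  rw [dirD, fderiv_fun_add (differentiableAt_of_contDiffOn hW hu hy)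
    (differentiableAt_of_contDiffOn hW hv hy)]
  rfl

theorem dirD_const_mul {f : R4 → ℝ} (c : ℝ) (hW : IsOpen W) (hf : ContDiffOn ℝ ∞ f W)
    (hy : y ∈ W) : dirD X (fun z => c * f z) y = c * dirD X f y := by
  rw [dirD, fderiv_const_mul (differentiableAt_of_contDiffOn hW hf hy)]
  rfl

theorem dirD_neg : dirD X (fun z => -u z) y = -dirD X u y := by
  rw [dirD, fderiv_fun_neg]; rfl

theorem dirD_apply {f : R4 → E51} (hW : IsOpen W) (hf : ContDiffOn ℝ ∞ f W) (hy : y ∈ W)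
    (i : Fin 5) : dirD X (fun z => f z i) y = dirD X f y i := by
  have := (hasFDerivAt_pi'.1 (differentiableAt_of_contDiffOn hW hf hy).hasFDerivAt i).fderiv
  rw [dirD, this]; rfl

end Calculus

/-! ### Adapted frames -/

/-- Along the parametrized hypersurface `F` over the open set `W`, a unit normal field `N` and a
pseudo-orthonormal tangent frame field `e` in which the shape operator has the matrix `S`. -/
structure AdaptedFrame (F N : R4 → E51) (e : Fin 4 → R4 → R4) (S : Fin 4 → Fin 4 → R4 → ℝ)
    (W : Set R4) : Prop where
  isOpen : IsOpen W
  smooth_F : ContDiffOn ℝ ∞ F W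
  smooth_N : ContDiffOn ℝ ∞ N W
  smooth_e : ∀ a, ContDiffOn ℝ ∞ (e a) W
  smooth_S : ∀ a b, ContDiffOn ℝ ∞ (S a b) W
  gram : ∀ y ∈ W, ∀ a b, mink (dirD (e a) F y) (dirD (e b) F y) = η a b
  unit : ∀ y ∈ W, mink (N y) (N y) = 1
  normal : ∀ y ∈ W, ∀ a, mink (dirD (e a) F y) (N y) = 0
  weingarten : ∀ y ∈ W, ∀ a, dirD (e a) N y = -∑ c, S a c y • dirD (e c) F y

/-- The connection coefficients `⟨∇_{e_a} e_b, e_c⟩` of a frame field. -/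
noncomputable def connection (F : R4 → E51) (e : Fin 4 → R4 → R4) (a b c : Fin 4) (y : R4) : ℝ :=
  mink (dirD (e a) (dirD (e b) F) y) (dirD (e c) F y)

/-- The coefficients `⟨S e_a, e_b⟩` of the second fundamental form. -/
noncomputable def secondForm (S : Fin 4 → Fin 4 → R4 → ℝ) (a b : Fin 4) (y : R4) : ℝ :=
  ∑ c, S a c y * η c b

/-- The trace of the Hessian with respect to a pseudo-orthonormal frame. -/
noncomputable def frameLaplacian {V : Type*} [NormedAddCommGroup V] [NormedSpace ℝ V]
    (F : R4 → E51) (e : Fin 4 → R4 → R4) (u : R4 → V) (y : R4) : V :=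
  ∑ a, ∑ b, η a b • (dirD (e a) (dirD (e b) u) y -
    ∑ c, ∑ d, (η c d * connection F e a b d y) • dirD (e c) u y)

namespace AdaptedFrame

variable {F N : R4 → E51} {e : Fin 4 → R4 → R4} {S : Fin 4 → Fin 4 → R4 → ℝ} {W : Set R4}
  {y : R4} {V : Type*} [NormedAddCommGroup V] [NormedSpace ℝ V] {u : R4 → V}

theorem mono (H : AdaptedFrame F N e S W) {W' : Set R4} (hW' : IsOpen W') (h : W' ⊆ W) :
    AdaptedFrame F N e S W' where
  isOpen := hW'
  smooth_F := H.smooth_F.mono h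
  smooth_N := H.smooth_N.mono h
  smooth_e a := (H.smooth_e a).mono h
  smooth_S a b := (H.smooth_S a b).mono h
  gram y hy := H.gram y (h hy)
  unit y hy := H.unit y (h hy)
  normal y hy := H.normal y (h hy)
  weingarten y hy := H.weingarten y (h hy)

theorem smooth_dirD (H : AdaptedFrame F N e S W) (hu : ContDiffOn ℝ ∞ u W) (a : Fin 4) :
    ContDiffOn ℝ ∞ (dirD (e a) u) W :=
  contDiffOn_dirD H.isOpen (H.smooth_e a) hu

theorem smooth_connection (H : AdaptedFrame F N e S W) (a b c : Fin 4) :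
    ContDiffOn ℝ ∞ (connection F e a b c) W :=
  contDiffOn_mink (H.smooth_dirD (H.smooth_dirD H.smooth_F b) a) (H.smooth_dirD H.smooth_F c)

theorem fderiv_eq_sum (H : AdaptedFrame F N e S W) (hy : y ∈ W) (u : R4 → V) (v : R4) :
    fderiv ℝ u y v =
      ∑ c, ∑ d, (η c d * mink (fderiv ℝ F y v) (dirD (e d) F y)) • dirD (e c) u y := by
  have := vector_expansion (L := (fderiv ℝ F y).toLinearMap) (e := fun a => e a y) (by simp)
    (H.gram y hy) v
  conv_lhs => rw [this]
  simp only [map_sum, map_smul, Finset.sum_smul]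
  rfl

/-- The bracket of two frame fields in terms of the connection. -/
theorem commutator (H : AdaptedFrame F N e S W) (hu : ContDiffOn ℝ ∞ u W) (hy : y ∈ W)
    (a b : Fin 4) :
    dirD (e a) (dirD (e b) u) y - dirD (e b) (dirD (e a) u) y =
      ∑ c, ∑ d, (η c d * (connection F e a b d y - connection F e b a d y)) •
        dirD (e c) u y := by
  rw [dirD_commutator H.isOpen (H.smooth_e a) (H.smooth_e b) hu hy, H.fderiv_eq_sum hy,
    ← dirD_commutator H.isOpen (H.smooth_e a) (H.smooth_e b) H.smooth_F hy]
  simp only [mink_sub_left, connection]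

/-- Metric compatibility: the Gram matrix of the frame is constant. -/
theorem connection_skew (H : AdaptedFrame F N e S W) (hy : y ∈ W) (a b c : Fin 4) :
    connection F e a b c y + connection F e a c b y = 0 := by
  have h := dirD_mink (X := e a) H.isOpen (H.smooth_dirD H.smooth_F b) (H.smooth_dirD H.smooth_F c)
    hy
  rw [dirD_eq_zero_of_const H.isOpen (fun z hz => H.gram z hz b c) hy] at h
  rw [connection, connection, mink_comm _ (dirD (e b) F y)]
  exact h.symm

theorem mink_dirD_N (H : AdaptedFrame F N e S W) (hy : y ∈ W) (a b : Fin 4) :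
    mink (dirD (e a) N y) (dirD (e b) F y) = -secondForm S a b y := by
  rw [H.weingarten y hy]
  simp only [mink_neg_left, mink_sum_left, mink_smul_left, H.gram y hy, secondForm]

theorem mink_dirD_N_N (H : AdaptedFrame F N e S W) (hy : y ∈ W) (a : Fin 4) :
    mink (dirD (e a) N y) (N y) = 0 := by
  rw [H.weingarten y hy]
  simp only [mink_neg_left, mink_sum_left, mink_smul_left, H.normal y hy]
  simp

theorem mink_dirD_dirD_F_N (H : AdaptedFrame F N e S W) (hy : y ∈ W) (a b : Fin 4) :
    mink (dirD (e a) (dirD (e b) F) y) (N y) = secondForm S a b y := by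
  have h := dirD_mink (X := e a) H.isOpen (H.smooth_dirD H.smooth_F b) H.smooth_N hy
  rw [dirD_eq_zero_of_const H.isOpen (fun z hz => H.normal z hz b) hy, mink_comm (dirD (e b) F y),
    H.mink_dirD_N hy] at h
  linarith

/-- The frame Laplacian of the position vector is the trace of `S` times the normal. -/
theorem frameLaplacian_F (H : AdaptedFrame F N e S W) (hy : y ∈ W) :
    frameLaplacian F e F y = (∑ a, ∑ b, η a b * secondForm S a b y) • N y := by
  rw [frameLaplacian, Finset.sum_smul]
  refine Finset.sum_congr rfl fun a _ => ?_
  rw [Finset.sum_smul]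
  refine Finset.sum_congr rfl fun b _ => ?_
  have h := frame_expansion (H.gram y hy) (H.normal y hy) (H.unit y hy)
    (dirD (e a) (dirD (e b) F) y)
  rw [H.mink_dirD_dirD_F_N hy] at h
  rw [mul_smul]
  congr 1
  rw [sub_eq_iff_eq_add']
  exact h

/-- The tangential components of the second derivatives of the normal. -/
theorem mink_dirD_dirD_N (H : AdaptedFrame F N e S W) (hy : y ∈ W) (a b d : Fin 4) :
    mink (dirD (e a) (dirD (e b) N) y) (dirD (e d) F y) =
      -dirD (e a) (secondForm S b d) y + ∑ c, S b c y * connection F e a d c y := by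
  have h := dirD_mink (X := e a) H.isOpen (H.smooth_dirD H.smooth_N b) (H.smooth_dirD H.smooth_F d)
    hy
  rw [dirD_congr H.isOpen (fun z hz => H.mink_dirD_N hz b d) hy, dirD_neg] at h
  rw [eq_sub_of_add_eq h.symm, H.weingarten y hy b]
  simp only [mink_neg_left, mink_sum_left, mink_smul_left, connection, mink_comm (dirD (e _) F y)]
  ring

theorem mink_dirD_dirD_N_N (H : AdaptedFrame F N e S W) (hy : y ∈ W) (a b : Fin 4) :
    mink (dirD (e a) (dirD (e b) N) y) (N y) = -∑ c, S a c y * secondForm S b c y := by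
  have h := dirD_mink (X := e a) H.isOpen (H.smooth_dirD H.smooth_N b) H.smooth_N hy
  rw [dirD_eq_zero_of_const H.isOpen (fun z hz => H.mink_dirD_N_N hz b) hy] at h
  rw [eq_sub_of_add_eq h.symm, H.weingarten y hy a]
  simp only [mink_neg_right, mink_sum_right, mink_smul_right, H.mink_dirD_N hy]
  simp

/-- The Codazzi equation. -/
theorem codazzi (H : AdaptedFrame F N e S W) (hy : y ∈ W) (a b d : Fin 4) :
    dirD (e a) (secondForm S b d) y - ∑ c, S b c y * connection F e a d c y -
      (dirD (e b) (secondForm S a d) y - ∑ c, S a c y * connection F e b d c y) =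
    ∑ c, ∑ d', η c d' * (connection F e a b d' y - connection F e b a d' y) *
      secondForm S c d y := by
  -- Codazzi is the tangential component of the commutator formula applied to N.
  have h := congrArg (fun v => mink v (dirD (e d) F y)) (H.commutator H.smooth_N hy a b)
  simp only [mink_sub_left, mink_sum_left, mink_smul_left, H.mink_dirD_dirD_N hy,
    H.mink_dirD_N hy, mul_neg, Finset.sum_neg_distrib] at h
  linarith

/-- The Gauss equation. -/
theorem gauss (H : AdaptedFrame F N e S W) (hy : y ∈ W) (a b c d : Fin 4) :
    dirD (e a) (connection F e b c d) y - dirD (e b) (connection F e a c d) y =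
      (∑ p, ∑ q, η p q * connection F e b c p y * connection F e a d q y +
        secondForm S b c y * secondForm S a d y) -
      (∑ p, ∑ q, η p q * connection F e a c p y * connection F e b d q y +
        secondForm S a c y * secondForm S b d y) +
      ∑ p, ∑ q, η p q * (connection F e a b q y - connection F e b a q y) *
        connection F e p c d y := by
  have h1 : ∀ a b : Fin 4, dirD (e a) (connection F e b c d) y = _ := fun a b =>
    dirD_mink (X := e a) H.isOpen
      (H.smooth_dirD (H.smooth_dirD H.smooth_F c) b) (H.smooth_dirD H.smooth_F d) hy
  -- Gauss is the tangential component of the same formula applied to the frame vector `dirD (e c)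
  -- F`.
  have h := congrArg (fun v => mink v (dirD (e d) F y))
    (H.commutator (H.smooth_dirD H.smooth_F c) hy a b)
  simp only [mink_sub_left, mink_sum_left, mink_smul_left] at h
  -- Splitting both vectors into tangential and normal parts produces the connection products and
  -- the second-form products.
  have h2 : ∀ a b : Fin 4, mink (dirD (e b) (dirD (e c) F) y) (dirD (e a) (dirD (e d) F) y) = _ :=
    fun a b => mink_expansion (H.gram y hy) (H.normal y hy) (H.unit y hy) _ _
  simp only [H.mink_dirD_dirD_F_N hy] at h2
  rw [h1, h1, h2, h2]
  simp only [connection] at h ⊢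
  linarith

/-! ### The frame Laplacian of components and products -/

theorem frameLaplacian_apply (H : AdaptedFrame F N e S W) {f : R4 → E51}
    (hf : ContDiffOn ℝ ∞ f W) (hy : y ∈ W) (i : Fin 5) :
    frameLaplacian F e (fun z => f z i) y = frameLaplacian F e f y i := by
  have h : ∀ a b, dirD (e a) (dirD (e b) fun z => f z i) y = dirD (e a) (dirD (e b) f) y i := by
    intro a b
    rw [dirD_congr H.isOpen (fun z hz => dirD_apply H.isOpen hf hz i) hy,
      dirD_apply H.isOpen (H.smooth_dirD hf b) hy]
  simp only [frameLaplacian, h, dirD_apply H.isOpen hf hy, Finset.sum_apply, Pi.smul_apply,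
    Pi.sub_apply]

theorem frameLaplacian_smul (H : AdaptedFrame F N e S W) {f : R4 → ℝ}
    (hf : ContDiffOn ℝ ∞ f W) (hu : ContDiffOn ℝ ∞ u W) (hy : y ∈ W) :
    frameLaplacian F e (fun z => f z • u z) y = frameLaplacian F e f y • u y +
      (∑ a, ∑ b, (2 * η a b * dirD (e a) f y) • dirD (e b) u y) +
      f y • frameLaplacian F e u y := by
  have h : ∀ a b, dirD (e a) (dirD (e b) fun z => f z • u z) y =
      dirD (e a) (dirD (e b) f) y • u y + dirD (e b) f y • dirD (e a) u y +
        (dirD (e a) f y • dirD (e b) u y + f y • dirD (e a) (dirD (e b) u) y) := by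
    intro a b
    rw [dirD_congr H.isOpen (fun z hz => dirD_smul H.isOpen hf hu hz) hy,
      dirD_add (u := fun z => dirD (e b) f z • u z) (v := fun z => f z • dirD (e b) u z) H.isOpen
        ((H.smooth_dirD hf b).smul hu) (hf.smul (H.smooth_dirD hu b)) hy,
      dirD_smul H.isOpen (H.smooth_dirD hf b) hu hy,
      dirD_smul H.isOpen hf (H.smooth_dirD hu b) hy]
  have hs : ∑ a, ∑ b, (η a b * dirD (e b) f y) • dirD (e a) u y =
      ∑ a, ∑ b, (η a b * dirD (e a) f y) • dirD (e b) u y := by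
    rw [Finset.sum_comm]
    simp only [gram_symm]
  have hs2 : (∑ a, ∑ b, (2 * η a b * dirD (e a) f y) • dirD (e b) u y) =
      (∑ a, ∑ b, (η a b * dirD (e b) f y) • dirD (e a) u y) +
      ∑ a, ∑ b, (η a b * dirD (e a) f y) • dirD (e b) u y := by
    rw [hs, ← two_smul ℝ, Finset.smul_sum]
    simp only [Finset.smul_sum, smul_smul, mul_assoc]
  rw [hs2]
  simp only [frameLaplacian, h, dirD_smul H.isOpen hf hu hy, Finset.sum_smul, Finset.smul_sum,
    ← Finset.sum_add_distrib]
  refine Finset.sum_congr rfl fun a _ => Finset.sum_congr rfl fun b _ => ?_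
  simp only [smul_add, Finset.sum_add_distrib, smul_sub, Finset.smul_sum, smul_smul, smul_eq_mul]
  simp only [mul_sub, sub_smul, Finset.mul_sum, Finset.sum_smul, mul_comm, mul_left_comm]
  abel

/-! ### The coordinate Laplacian against the frame Laplacian -/

theorem pd_eq_dirD {u : R4 → ℝ} (i : Fin 4) :
    pd i u = dirD (fun _ => EuclideanSpace.single i 1) u := rfl

theorem pd_pd (H : AdaptedFrame F N e S W) {u : R4 → ℝ} (hu : ContDiffOn ℝ ∞ u W) (hy : y ∈ W)
    (i j : Fin 4) : pd i (pd j u) y =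
      fderiv ℝ (fderiv ℝ u) y (EuclideanSpace.single i 1) (EuclideanSpace.single j 1) := by
  rw [pd_eq_dirD, pd_eq_dirD, dirD_dirD H.isOpen contDiffOn_const hu hy]
  simp

/-- Each derivative of gᵢⱼ = ⟨∂ᵢF, ∂ⱼF⟩ is a sum of two products; in the Christoffel combination
four of the six cancel by symmetry of ∂²F, and the other two coincide. -/
theorem christoffel_eq (H : AdaptedFrame F N e S W) (hy : y ∈ W) (k i j : Fin 4) :
    christoffel (inducedMetric F) k i j y = ∑ l, (inducedMetric F y)⁻¹ k l *
      mink (fderiv ℝ (fderiv ℝ F) y (EuclideanSpace.single i 1) (EuclideanSpace.single j 1))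
        (fderiv ℝ F y (EuclideanSpace.single l 1)) := by
  have h : ∀ i j l : Fin 4, pd i (fun z => inducedMetric F z j l) y =
      mink (fderiv ℝ (fderiv ℝ F) y (EuclideanSpace.single i 1) (EuclideanSpace.single j 1))
        (fderiv ℝ F y (EuclideanSpace.single l 1)) +
      mink (fderiv ℝ (fderiv ℝ F) y (EuclideanSpace.single i 1) (EuclideanSpace.single l 1))
        (fderiv ℝ F y (EuclideanSpace.single j 1)) := by
    intro i j l
    have hs : ∀ j : Fin 4, ContDiffOn ℝ ∞ (dirD (fun _ => EuclideanSpace.single j 1) F) W :=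
      fun j => contDiffOn_dirD H.isOpen contDiffOn_const H.smooth_F
    have := dirD_mink (X := fun _ => EuclideanSpace.single i 1) H.isOpen (hs j) (hs l) hy
    rw [dirD_dirD H.isOpen contDiffOn_const H.smooth_F hy,
      dirD_dirD H.isOpen contDiffOn_const H.smooth_F hy, mink_comm (dirD _ F y)] at this
    simp only [fderiv_fun_const, Pi.zero_apply, _root_.zero_apply, map_zero, add_zero] at this
    exact this
  rw [christoffel, Finset.mul_sum]
  refine Finset.sum_congr rfl fun l _ => ?_
  rw [h, h, h, snd_fderiv_symm H.isOpen H.smooth_F hy (EuclideanSpace.single j 1)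
    (EuclideanSpace.single i 1), snd_fderiv_symm H.isOpen H.smooth_F hy (EuclideanSpace.single l 1)
    (EuclideanSpace.single i 1), snd_fderiv_symm H.isOpen H.smooth_F hy (EuclideanSpace.single l 1)
    (EuclideanSpace.single j 1)]
  ring

/-- The Laplace operator of the induced metric is minus the frame Laplacian. -/
theorem laplacian_eq (H : AdaptedFrame F N e S W) {u : R4 → ℝ} (hu : ContDiffOn ℝ ∞ u W)
    (hy : y ∈ W) : laplacian (inducedMetric F) u y = -frameLaplacian F e u y := by
  have hΓ : ∀ i j, ∑ k, christoffel (inducedMetric F) k i j y * pd k u y =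
      ∑ c, ∑ d, η c d * (dirD (e c) u y * mink (fderiv ℝ (fderiv ℝ F) y
        (EuclideanSpace.single i 1) (EuclideanSpace.single j 1)) (dirD (e d) F y)) := by
    intro i j
    have := sum_inv_metric_eq (H.gram y hy) (g := inducedMetric F y) (fun _ _ => rfl)
      (LinearMap.mk₂ ℝ (fun v w => fderiv ℝ u y v * mink (fderiv ℝ (fderiv ℝ F) y
        (EuclideanSpace.single i 1) (EuclideanSpace.single j 1)) (fderiv ℝ F y w))
        (by intros; simp only [map_add]; ring) (by intros; simp only [map_smul, smul_eq_mul]; ring)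
        (by intros; simp only [map_add, mink_add_right]; ring)
        (by intros; simp only [map_smul, smul_eq_mul, mink_smul_right]; ring))
    simp only [LinearMap.mk₂_apply] at this
    simp only [dirD]
    rw [← this]
    simp only [H.christoffel_eq hy, Finset.sum_mul, pd]
    refine Finset.sum_congr rfl fun _ _ => Finset.sum_congr rfl fun _ _ => by ring
  -- The bilinear form is the covariant Hessian of u; its trace is moved from the coordinate basis
  -- to the frame.
  have hB := sum_inv_metric_eq (H.gram y hy) (g := inducedMetric F y) (fun _ _ => rfl)
    (LinearMap.mk₂ ℝ (fun v w => fderiv ℝ (fderiv ℝ u) y v w -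
        ∑ c, ∑ d, η c d * (dirD (e c) u y * mink (fderiv ℝ (fderiv ℝ F) y v w) (dirD (e d) F y)))
      (by
        intros
        simp only [map_add, _root_.add_apply, mink_add_left, mul_add, Finset.sum_add_distrib]
        ring)
      (by
        intros
        simp only [map_smul, _root_.smul_apply, mink_smul_left, smul_eq_mul, mul_sub,
          Finset.mul_sum]
        congr 1
        refine Finset.sum_congr rfl fun _ _ => Finset.sum_congr rfl fun _ _ => by ring)
      (by
        intros
        simp only [map_add, mink_add_left, mul_add, Finset.sum_add_distrib]
        ring)
      (by
        intros
        simp only [map_smul, mink_smul_left, smul_eq_mul, mul_sub, Finset.mul_sum]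
        congr 1
        refine Finset.sum_congr rfl fun _ _ => Finset.sum_congr rfl fun _ _ => by ring))
  simp only [LinearMap.mk₂_apply] at hB
  simp only [laplacian, hΓ, H.pd_pd hu hy]
  rw [hB, frameLaplacian]
  congr 1
  refine Finset.sum_congr rfl fun a _ => Finset.sum_congr rfl fun b _ => ?_
  rw [smul_eq_mul]
  congr 1
  -- The derivative of `e b` enters twice, through `dirD (e b) u` and through the connection;
  -- expanding it in the frame shows that the two contributions cancel.
  have h1 := dirD_dirD (X := e a) H.isOpen (H.smooth_e b) hu hy
  have h2 := dirD_dirD (X := e a) H.isOpen (H.smooth_e b) H.smooth_F hy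
  have h3 := H.fderiv_eq_sum hy u (fderiv ℝ (e b) y (e a y))
  rw [← sub_eq_iff_eq_add] at h1 h2
  rw [← h1, ← h2, h3, sub_sub]
  simp only [← Finset.sum_add_distrib, mink_sub_left, connection, smul_eq_mul]
  congr 1
  refine Finset.sum_congr rfl fun _ _ => Finset.sum_congr rfl fun _ _ => by ring

end AdaptedFrame

/-! ### The shape operator with a triple eigenvalue and a nilpotent part of rank two -/

/-- The matrix of the shape operator, row `a` holding the components of `S e_a`. -/
noncomputable def shapeMatrix (k₁ k₄ : R4 → ℝ) (a c : Fin 4) (y : R4) : ℝ :=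
  !![k₁ y, 0, -1, 0;
     0, k₁ y, 0, 0;
     0, 1, k₁ y, 0;
     0, 0, 0, k₄ y] a c

/-- The trace of the shape operator. -/
noncomputable def shapeTrace (k₁ k₄ : R4 → ℝ) (y : R4) : ℝ := 3 * k₁ y + k₄ y

theorem secondForm_shapeMatrix (k₁ k₄ : R4 → ℝ) (a b : Fin 4) (y : R4) :
    secondForm (shapeMatrix k₁ k₄) a b y =
      !![0, -k₁ y, -1, 0;
         -k₁ y, 0, 0, 0;
         -1, 0, k₁ y, 0;
         0, 0, 0, k₄ y] a b := by
  fin_cases a <;> fin_cases b <;>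
    simp [secondForm, shapeMatrix, pseudoOrthonormalGram, Fin.sum_univ_four]

theorem dirD_secondForm_shapeMatrix (k₁ k₄ : R4 → ℝ) (X : R4 → R4) (a b : Fin 4) (y : R4) :
    dirD X (secondForm (shapeMatrix k₁ k₄) a b) y =
      !![0, -dirD X k₁ y, 0, 0;
         -dirD X k₁ y, 0, 0, 0;
         0, 0, dirD X k₁ y, 0;
         0, 0, 0, dirD X k₄ y] a b := by
  have h : secondForm (shapeMatrix k₁ k₄) a b = _ :=
    funext fun z => secondForm_shapeMatrix k₁ k₄ a b z
  rw [h]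
  fin_cases a <;> fin_cases b <;> simp [dirD_neg] <;> simp [dirD]

theorem sum_gram_secondForm_shapeMatrix (k₁ k₄ : R4 → ℝ) (y : R4) :
    ∑ a, ∑ b, η a b * secondForm (shapeMatrix k₁ k₄) a b y = shapeTrace k₁ k₄ y := by
  simp [secondForm_shapeMatrix, Fin.sum_univ_four, pseudoOrthonormalGram, shapeTrace]
  ring

namespace AdaptedFrame

variable {F N : R4 → E51} {e : Fin 4 → R4 → R4} {W : Set R4} {y : R4}

/-- Rewriting rules that bring the last two indices into increasing order, so that equal
coefficients become equal atoms for `linarith`. -/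
theorem connection_skew_rules {S : Fin 4 → Fin 4 → R4 → ℝ} (H : AdaptedFrame F N e S W)
    (hy : y ∈ W) :
    (∀ a b, connection F e a b b y = 0) ∧
    (∀ a, connection F e a 1 0 y = -connection F e a 0 1 y) ∧
    (∀ a, connection F e a 2 0 y = -connection F e a 0 2 y) ∧
    (∀ a, connection F e a 3 0 y = -connection F e a 0 3 y) ∧
    (∀ a, connection F e a 2 1 y = -connection F e a 1 2 y) ∧
    (∀ a, connection F e a 3 1 y = -connection F e a 1 3 y) ∧
    (∀ a, connection F e a 3 2 y = -connection F e a 2 3 y) := by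
  have h := fun a b c => H.connection_skew hy a b c
  refine ⟨fun a b => by linarith [h a b b], fun a => by linarith [h a 1 0],
    fun a => by linarith [h a 2 0], fun a => by linarith [h a 3 0], fun a => by linarith [h a 2 1],
    fun a => by linarith [h a 3 1], fun a => by linarith [h a 3 2]⟩

variable {k₁ k₄ : R4 → ℝ}

theorem smooth_k₁ (H : AdaptedFrame F N e (shapeMatrix k₁ k₄) W) : ContDiffOn ℝ ∞ k₁ W :=
  H.smooth_S 0 0

theorem smooth_k₄ (H : AdaptedFrame F N e (shapeMatrix k₁ k₄) W) : ContDiffOn ℝ ∞ k₄ W :=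
  H.smooth_S 3 3

theorem smooth_shapeTrace (H : AdaptedFrame F N e (shapeMatrix k₁ k₄) W) :
    ContDiffOn ℝ ∞ (shapeTrace k₁ k₄) W :=
  (contDiffOn_const.mul H.smooth_k₁).add H.smooth_k₄

theorem dirD_shapeTrace (H : AdaptedFrame F N e (shapeMatrix k₁ k₄) W) (hy : y ∈ W)
    (X : R4 → R4) : dirD X (shapeTrace k₁ k₄) y = 3 * dirD X k₁ y + dirD X k₄ y := by
  rw [← dirD_const_mul 3 H.isOpen H.smooth_k₁ hy]
  exact dirD_add (u := fun z => 3 * k₁ z) H.isOpen (contDiffOn_const.mul H.smooth_k₁) H.smooth_k₄ hy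

/-! ### Normal and tangential parts of the biharmonic equation -/

theorem mink_frameLaplacian_N_N (H : AdaptedFrame F N e (shapeMatrix k₁ k₄) W) (hy : y ∈ W) :
    mink (frameLaplacian F e N y) (N y) = -(3 * k₁ y ^ 2 + k₄ y ^ 2) := by
  simp only [frameLaplacian, mink_sum_left, mink_smul_left, mink_sub_left, H.mink_dirD_dirD_N_N hy,
    H.mink_dirD_N_N hy]
  simp [secondForm_shapeMatrix, Fin.sum_univ_four, pseudoOrthonormalGram, shapeMatrix]
  ring

/-- This is div S = ∇ tr S, the contracted Codazzi equation. The four instances used are those whose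
first and last indices have a nonzero entry in η. -/
theorem mink_frameLaplacian_N_tangent (H : AdaptedFrame F N e (shapeMatrix k₁ k₄) W) (hy : y ∈ W)
    (d : Fin 4) :
    mink (frameLaplacian F e N y) (dirD (e d) F y) = -dirD (e d) (shapeTrace k₁ k₄) y := by
  obtain ⟨h0, h1, h2, h3, h4, h5, h6⟩ := H.connection_skew_rules hy
  have c0 := H.codazzi hy 0 d 1
  have c1 := H.codazzi hy 1 d 0
  have c2 := H.codazzi hy 2 d 2
  have c3 := H.codazzi hy 3 d 3
  simp only [frameLaplacian, mink_sum_left, mink_smul_left, mink_sub_left, H.mink_dirD_dirD_N hy,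
    H.mink_dirD_N hy, H.dirD_shapeTrace hy]
  fin_cases d <;>
  · simp [dirD_secondForm_shapeMatrix, secondForm_shapeMatrix, Fin.sum_univ_four,
      pseudoOrthonormalGram, shapeMatrix, h0, h1, h2, h3, h4, h5, h6] at c0 c1 c2 c3 ⊢
    linarith

theorem mink_frameLaplacian_smul_N (H : AdaptedFrame F N e (shapeMatrix k₁ k₄) W) (hy : y ∈ W) :
    mink (frameLaplacian F e (fun z => shapeTrace k₁ k₄ z • N z) y) (N y) =
      frameLaplacian F e (shapeTrace k₁ k₄) y -
        shapeTrace k₁ k₄ y * (3 * k₁ y ^ 2 + k₄ y ^ 2) := by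
  rw [H.frameLaplacian_smul H.smooth_shapeTrace H.smooth_N hy]
  simp only [mink_add_left, mink_smul_left, mink_sum_left, H.unit y hy, H.mink_dirD_N_N hy,
    H.mink_frameLaplacian_N_N hy]
  simp
  ring

/-- The cross term of the product rule contributes -2 S∇f, and f · L N contributes -f∇f. -/
theorem mink_frameLaplacian_smul_N_tangent (H : AdaptedFrame F N e (shapeMatrix k₁ k₄) W)
    (hy : y ∈ W) (d : Fin 4) :
    mink (frameLaplacian F e (fun z => shapeTrace k₁ k₄ z • N z) y) (dirD (e d) F y) =
      -(2 * ∑ a, ∑ b, η a b * dirD (e a) (shapeTrace k₁ k₄) y *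
        secondForm (shapeMatrix k₁ k₄) b d y +
        shapeTrace k₁ k₄ y * dirD (e d) (shapeTrace k₁ k₄) y) := by
  rw [H.frameLaplacian_smul H.smooth_shapeTrace H.smooth_N hy]
  simp only [mink_add_left, mink_smul_left, mink_sum_left, mink_comm (N y), H.normal y hy,
    H.mink_dirD_N hy, H.mink_frameLaplacian_N_tangent hy, Finset.mul_sum, mul_neg,
    Finset.sum_neg_distrib, mul_assoc]
  ring

/-- The normal part of the biharmonic equation. -/
theorem frameLaplacian_shapeTrace (H : AdaptedFrame F N e (shapeMatrix k₁ k₄) W) (hy : y ∈ W)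
    (hB : frameLaplacian F e (fun z => shapeTrace k₁ k₄ z • N z) y = 0) :
    frameLaplacian F e (shapeTrace k₁ k₄) y =
      shapeTrace k₁ k₄ y * (3 * k₁ y ^ 2 + k₄ y ^ 2) := by
  have h := H.mink_frameLaplacian_smul_N hy
  rw [hB, mink_zero_left] at h
  linarith

/-- The tangential part of the biharmonic equation. -/
theorem gradient_system (H : AdaptedFrame F N e (shapeMatrix k₁ k₄) W) (hy : y ∈ W)
    (hB : frameLaplacian F e (fun z => shapeTrace k₁ k₄ z • N z) y = 0) :
    2 * (k₁ y * dirD (e 0) (shapeTrace k₁ k₄) y - dirD (e 2) (shapeTrace k₁ k₄) y) +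
      shapeTrace k₁ k₄ y * dirD (e 0) (shapeTrace k₁ k₄) y = 0 ∧
    (2 * k₁ y + shapeTrace k₁ k₄ y) * dirD (e 1) (shapeTrace k₁ k₄) y = 0 ∧
    2 * dirD (e 1) (shapeTrace k₁ k₄) y +
      (2 * k₁ y + shapeTrace k₁ k₄ y) * dirD (e 2) (shapeTrace k₁ k₄) y = 0 ∧
    (2 * k₄ y + shapeTrace k₁ k₄ y) * dirD (e 3) (shapeTrace k₁ k₄) y = 0 := by
  have h := H.mink_frameLaplacian_smul_N_tangent hy
  simp only [hB, mink_zero_left] at h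
  have h0 := h 0
  have h1 := h 1
  have h2 := h 2
  have h3 := h 3
  simp only [secondForm_shapeMatrix, Fin.sum_univ_four] at h0 h1 h2 h3
  simp [pseudoOrthonormalGram] at h0 h1 h2 h3
  refine ⟨?_, ?_, ?_, ?_⟩
  · linear_combination h0
  · linear_combination h1
  · linear_combination h2
  · linear_combination h3

/-! ### Excluding a nonzero gradient of the mean curvature -/

theorem dirD_of_eq_const_mul (H : AdaptedFrame F N e (shapeMatrix k₁ k₄) W) {f : R4 → ℝ} (c : ℝ)
    (h : ∀ z ∈ W, f z = c * k₁ z) (hy : y ∈ W) (X : R4 → R4) :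
    dirD X f y = c * dirD X k₁ y := by
  rw [dirD_congr H.isOpen h hy, dirD_const_mul c H.isOpen H.smooth_k₁ hy]

/-- If the gradient of the mean curvature is a light-like eigenvector of the shape operator, the
mean curvature is harmonic. -/
theorem frameLaplacian_eq_zero_of_lightlike (H : AdaptedFrame F N e (shapeMatrix k₁ k₄) W)
    (hk : ∀ z ∈ W, k₄ z = -5 * k₁ z) (h1 : ∀ z ∈ W, dirD (e 1) (shapeTrace k₁ k₄) z = 0)
    (h2 : ∀ z ∈ W, dirD (e 2) (shapeTrace k₁ k₄) z = 0)
    (h3 : ∀ z ∈ W, dirD (e 3) (shapeTrace k₁ k₄) z = 0) (hy : y ∈ W) (hky : k₁ y ≠ 0) :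
    frameLaplacian F e (shapeTrace k₁ k₄) y = 0 := by
  have hD : ∀ X, dirD X (shapeTrace k₁ k₄) y = -2 * dirD X k₁ y :=
    H.dirD_of_eq_const_mul (-2) (fun z hz => by rw [shapeTrace, hk z hz]; ring) hy
  have hD4 := H.dirD_of_eq_const_mul (-5) hk hy
  have d1 : dirD (e 1) k₁ y = 0 := by linarith [h1 y hy, hD (e 1)]
  have d2 : dirD (e 2) k₁ y = 0 := by linarith [h2 y hy, hD (e 2)]
  have d3 : dirD (e 3) k₁ y = 0 := by linarith [h3 y hy, hD (e 3)]
  have z1 := fun a => dirD_eq_zero_of_const (X := e a) H.isOpen h1 hy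
  have z2 := fun a => dirD_eq_zero_of_const (X := e a) H.isOpen h2 hy
  have z3 := fun a => dirD_eq_zero_of_const (X := e a) H.isOpen h3 hy
  -- The only second derivative left in L f is e₁e₀f; since e₀e₁f = 0, it is a bracket term. This
  -- leaves L f = -(⟨∇_{e₂}e₁, e₂⟩ + ⟨∇_{e₃}e₁, e₃⟩) e₀f, and Codazzi annihilates both coefficients.
  have hc := H.commutator H.smooth_shapeTrace hy 0 1
  obtain ⟨s0, s1, s2, s3, s4, s5, s6⟩ := H.connection_skew_rules hy
  have c021 := H.codazzi hy 0 2 1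
  have c313 := H.codazzi hy 1 3 3
  simp only [dirD_secondForm_shapeMatrix, secondForm_shapeMatrix, shapeMatrix, hD4,
    Fin.sum_univ_four, s0, s1, s2, s3, s4, s5, s6, hk y hy] at c021 c313
  simp [pseudoOrthonormalGram, d1, d2] at c021 c313
  have w331 : connection F e 3 1 3 y = 0 := by
    -- The Codazzi coefficient is k₁ - k₄ = 6k₁.
    have : k₁ y * connection F e 3 1 3 y = 0 := by linarith
    exact (mul_eq_zero.1 this).resolve_left hky
  have w221 : connection F e 2 1 2 y = 0 := by linarith
  simp only [frameLaplacian, Fin.sum_univ_four, s0, s1, s2, s3, s4, s5, s6, z1, z2, z3, h1 y hy,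
    h2 y hy, h3 y hy] at hc ⊢
  simp [pseudoOrthonormalGram, w331, w221] at hc ⊢
  linarith

/-- The gradient of the mean curvature cannot be a space-like eigenvector of the shape operator. -/
theorem k₁_eq_zero_of_spacelike (H : AdaptedFrame F N e (shapeMatrix k₁ k₄) W)
    (hk : ∀ z ∈ W, k₄ z = -1 * k₁ z) (hk0 : ∀ z ∈ W, k₁ z ≠ 0)
    (h0 : ∀ z ∈ W, dirD (e 0) (shapeTrace k₁ k₄) z = 0)
    (h1 : ∀ z ∈ W, dirD (e 1) (shapeTrace k₁ k₄) z = 0)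
    (h2 : ∀ z ∈ W, dirD (e 2) (shapeTrace k₁ k₄) z = 0)
    (h3 : ∀ z ∈ W, dirD (e 3) (shapeTrace k₁ k₄) z ≠ 0)
    (hB : ∀ z ∈ W, frameLaplacian F e (fun z => shapeTrace k₁ k₄ z • N z) z = 0) (hy : y ∈ W) :
    k₁ y = 0 := by
  have hf : ∀ z ∈ W, shapeTrace k₁ k₄ z = 2 * k₁ z := fun z hz => by
    rw [shapeTrace, hk z hz]; ring
  have hD : ∀ z ∈ W, ∀ X, dirD X (shapeTrace k₁ k₄) z = 2 * dirD X k₁ z :=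
    fun z hz => H.dirD_of_eq_const_mul 2 hf hz
  have hz0 : ∀ z ∈ W, ∀ a, dirD (e a) (dirD (e 0) (shapeTrace k₁ k₄)) z = 0 :=
    fun z hz a => dirD_eq_zero_of_const H.isOpen h0 hz
  have hz1 : ∀ z ∈ W, ∀ a, dirD (e a) (dirD (e 1) (shapeTrace k₁ k₄)) z = 0 :=
    fun z hz a => dirD_eq_zero_of_const H.isOpen h1 hz
  have hz2 : ∀ z ∈ W, ∀ a, dirD (e a) (dirD (e 2) (shapeTrace k₁ k₄)) z = 0 :=
    fun z hz a => dirD_eq_zero_of_const H.isOpen h2 hz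
  -- These relations are needed on all of W, because the first and the last of them are
  -- differentiated below.
  have key : ∀ z ∈ W, connection F e 3 3 0 z = 0 ∧ connection F e 3 1 3 z = 0 ∧
      connection F e 3 2 3 z = 0 ∧ connection F e 1 1 3 z = 0 ∧ connection F e 1 2 3 z = 0 ∧
      connection F e 3 1 2 z = 0 ∧ connection F e 0 1 3 z = connection F e 1 0 3 z ∧
      connection F e 2 2 3 z = -connection F e 1 0 3 z ∧
      dirD (e 3) k₁ z = 2 * (k₁ z * connection F e 1 3 0 z) := by
    intro z hz
    obtain ⟨s0, s1, s2, s3, s4, s5, s6⟩ := H.connection_skew_rules hz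
    have hk0z := hk0 z hz
    have d0 : dirD (e 0) k₁ z = 0 := by linarith [h0 z hz, hD z hz (e 0)]
    have d1 : dirD (e 1) k₁ z = 0 := by linarith [h1 z hz, hD z hz (e 1)]
    have d2 : dirD (e 2) k₁ z = 0 := by linarith [h2 z hz, hD z hz (e 2)]
    have c031 := H.codazzi hz 0 3 1
    have c032 := H.codazzi hz 0 3 2
    have c033 := H.codazzi hz 0 3 3
    have c130 := H.codazzi hz 1 3 0
    have c131 := H.codazzi hz 1 3 1
    have c132 := H.codazzi hz 1 3 2
    have c133 := H.codazzi hz 1 3 3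
    have c230 := H.codazzi hz 2 3 0
    have c231 := H.codazzi hz 2 3 1
    have c232 := H.codazzi hz 2 3 2
    have c233 := H.codazzi hz 2 3 3
    simp only [dirD_secondForm_shapeMatrix, secondForm_shapeMatrix, shapeMatrix, hk z hz,
      H.dirD_of_eq_const_mul (-1) hk hz,
      Fin.sum_univ_four, s0, s1, s2, s3, s4, s5, s6]
      at c031 c032 c033 c130 c131 c132 c133 c230 c231 c232 c233
    simp [pseudoOrthonormalGram, d0, d1, d2]
      at c031 c032 c033 c130 c131 c132 c133 c230 c231 c232 c233
    -- Only e₃f is nonzero, so [e₀, e₂]f = 0 says that [e₀, e₂] has no e₃ component.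
    have hc := H.commutator H.smooth_shapeTrace hz 0 2
    simp only [Fin.sum_univ_four, s0, s2, s4, h0 z hz, h1 z hz, h2 z hz, hz0 z hz,
      hz2 z hz] at hc
    simp [pseudoOrthonormalGram, h3 z hz] at hc
    have cancel : ∀ {t : ℝ}, k₁ z * t = 0 → t = 0 := fun h => (mul_eq_zero.1 h).resolve_left hk0z
    have w113 : connection F e 1 1 3 z = 0 := cancel (by linarith)
    have w313 : connection F e 3 1 3 z = 0 := cancel (by linarith)
    have w323 : connection F e 3 2 3 z = 0 := cancel (by linarith)
    have w303 : connection F e 3 0 3 z = 0 := cancel (by linarith)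
    have w123 : connection F e 1 2 3 z = 0 := cancel (by linarith)
    have w213 : connection F e 2 1 3 z = 0 := cancel (by linarith)
    have hsum : connection F e 0 1 3 z = -connection F e 2 2 3 z := by
      linear_combination c032 - c230 - 2 * k₁ z * hc
    have w312 : connection F e 3 1 2 z = 0 := by
      rw [hsum] at c031
      linarith
    have w013 : connection F e 0 1 3 z = connection F e 1 0 3 z :=
      sub_eq_zero.1 (cancel (by linarith))
    refine ⟨by rw [s3, w303, neg_zero], w313, w323, w113, w123, w312, w013, by linarith, ?_⟩
    rw [s3]
    linarith
  obtain ⟨w330, w313, w323, w113, w123, w312, w013, w223, hα⟩ := key y hy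
  obtain ⟨s0, s1, s2, s3, s4, s5, s6⟩ := H.connection_skew_rules hy
  have w303 : connection F e 3 0 3 y = 0 := by linarith [s3 3]
  have d0 : dirD (e 0) k₁ y = 0 := by linarith [h0 y hy, hD y hy (e 0)]
  have d1 : dirD (e 1) k₁ y = 0 := by linarith [h1 y hy, hD y hy (e 1)]
  have d2 : dirD (e 2) k₁ y = 0 := by linarith [h2 y hy, hD y hy (e 2)]
  -- With ω = `connection F e 1 3 0`, this becomes e₃ω = ω² - k₁².
  have g := H.gauss hy 1 3 3 0
  rw [dirD_eq_zero_of_const H.isOpen (fun z hz => (key z hz).1) hy] at g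
  simp only [secondForm_shapeMatrix, Fin.sum_univ_four, s0, s1, s3, s5, s6, w303, w313,
    w323, w113, w123, w312, hk y hy] at g
  simp [pseudoOrthonormalGram] at g
  have hL := H.frameLaplacian_shapeTrace hy (hB y hy)
  have hDD : dirD (e 3) (dirD (e 3) (shapeTrace k₁ k₄)) y =
      4 * (dirD (e 3) k₁ y * connection F e 1 3 0 y +
        k₁ y * dirD (e 3) (connection F e 1 3 0) y) := by
    rw [← dirD_mul H.isOpen H.smooth_k₁ (H.smooth_connection 1 3 0) hy,
      ← dirD_const_mul 4 H.isOpen (H.smooth_k₁.mul (H.smooth_connection 1 3 0)) hy]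
    refine dirD_congr H.isOpen (fun z hz => ?_) hy
    rw [hD z hz, (key z hz).2.2.2.2.2.2.2.2]
    ring
  simp only [frameLaplacian, Fin.sum_univ_four, s0, s1, s2, s4, s5, s6, hz0 y hy, hz1 y hy,
    hz2 y hy, hDD, hD y hy, d0, d1, d2, w313, w323, w113, w123, w312, w013, w223,
    hα, hf y hy, hk y hy] at hL
  simp [pseudoOrthonormalGram, s3] at hL g
  -- Here `hL` reads 4k₁(e₃ω - ω²) = 8k₁³; inserting `g` gives 12k₁³ = 0.
  have : k₁ y ^ 3 = 0 := by
    linear_combination -(1 / 12) * hL - k₁ y / 3 * g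
  exact pow_eq_zero_iff (by norm_num) |>.1 this

theorem frameLaplacian_eq_zero_of_gradient {S : Fin 4 → Fin 4 → R4 → ℝ}
    (H : AdaptedFrame F N e S W) {u : R4 → ℝ} (h : ∀ z ∈ W, ∀ a, dirD (e a) u z = 0)
    (hy : y ∈ W) : frameLaplacian F e u y = 0 := by
  have hz : ∀ a b, dirD (e a) (dirD (e b) u) y = 0 :=
    fun a b => dirD_eq_zero_of_const H.isOpen (fun z hz => h z hz b) hy
  simp [frameLaplacian, hz, h y hy]

/-- A hypersurface whose gradient of mean curvature does not vanish is not biharmonic. -/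
theorem dirD_shapeTrace_eq_zero (H : AdaptedFrame F N e (shapeMatrix k₁ k₄) W)
    (hB : ∀ z ∈ W, frameLaplacian F e (fun z => shapeTrace k₁ k₄ z • N z) z = 0) (hy : y ∈ W)
    (hf : shapeTrace k₁ k₄ y ≠ 0) (a : Fin 4) : dirD (e a) (shapeTrace k₁ k₄) y = 0 := by
  by_contra ha
  have hcf : ContinuousOn (shapeTrace k₁ k₄) W := H.smooth_shapeTrace.continuousOn
  have hca : ContinuousOn (dirD (e a) (shapeTrace k₁ k₄)) W :=
    (H.smooth_dirD H.smooth_shapeTrace a).continuousOn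
  have hck : ContinuousOn k₁ W := H.smooth_k₁.continuousOn
  have hne : IsOpen ({0}ᶜ : Set ℝ) := isOpen_compl_singleton
  -- The case arguments differentiate their assumptions, so all inequalities are first spread to an
  -- open neighbourhood of y.
  set W₀ := (W ∩ shapeTrace k₁ k₄ ⁻¹' {0}ᶜ) ∩ (W ∩ dirD (e a) (shapeTrace k₁ k₄) ⁻¹' {0}ᶜ)
  have hW₀o : IsOpen W₀ :=
    (hcf.isOpen_inter_preimage H.isOpen hne).inter (hca.isOpen_inter_preimage H.isOpen hne)
  by_cases hcase : 2 * k₁ y + shapeTrace k₁ k₄ y = 0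
  · -- light-like gradient
    have hy3 : 2 * k₄ y + shapeTrace k₁ k₄ y ≠ 0 := by
      intro h
      apply hf
      simp only [shapeTrace] at *
      linarith
    set W₁ := W₀ ∩ (W ∩ (fun z => 2 * k₄ z + shapeTrace k₁ k₄ z) ⁻¹' {0}ᶜ)
    have hW₁o : IsOpen W₁ := hW₀o.inter (ContinuousOn.isOpen_inter_preimage
      ((continuousOn_const.mul H.smooth_k₄.continuousOn).add hcf) H.isOpen hne)
    have hyW : y ∈ W₁ := ⟨⟨⟨hy, hf⟩, hy, ha⟩, hy, hy3⟩
    have H' := H.mono hW₁o fun z hz => hz.2.1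
    have hall : ∀ z ∈ W₁, k₄ z = -5 * k₁ z ∧ dirD (e 1) (shapeTrace k₁ k₄) z = 0 ∧
        dirD (e 2) (shapeTrace k₁ k₄) z = 0 ∧ dirD (e 3) (shapeTrace k₁ k₄) z = 0 := by
      rintro z ⟨⟨_, _, hza⟩, hz, hz3⟩
      obtain ⟨g0, g1, g2, g3⟩ := H.gradient_system hz (hB z hz)
      have d3 := (mul_eq_zero.1 g3).resolve_left hz3
      -- The equation known at y persists nearby: were it to fail at z, the triangular gradient
      -- system would kill every derivative of f, including the nonzero one along `e a`.
      have hk : 2 * k₁ z + shapeTrace k₁ k₄ z = 0 := by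
        by_contra hk
        have d1 := (mul_eq_zero.1 g1).resolve_left hk
        rw [d1, mul_zero, zero_add] at g2
        have d2 := (mul_eq_zero.1 g2).resolve_left hk
        rw [d2] at g0
        have d0 := (mul_eq_zero.1 (by linear_combination g0 :
          (2 * k₁ z + shapeTrace k₁ k₄ z) * dirD (e 0) (shapeTrace k₁ k₄) z = 0)).resolve_left hk
        exact hza (by fin_cases a <;> assumption)
      rw [hk, zero_mul, add_zero] at g2
      have d1 : dirD (e 1) (shapeTrace k₁ k₄) z = 0 := by linarith
      refine ⟨by simp only [shapeTrace] at hk; linarith, d1, ?_, d3⟩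
      linear_combination (1 / 2) * (-g0 + dirD (e 0) (shapeTrace k₁ k₄) z * hk)
    have hk₁ : k₁ y ≠ 0 := fun h => hf (by rw [h] at hcase; linarith)
    have hL := H'.frameLaplacian_eq_zero_of_lightlike (fun z hz => (hall z hz).1)
      (fun z hz => (hall z hz).2.1) (fun z hz => (hall z hz).2.2.1)
      (fun z hz => (hall z hz).2.2.2) hyW hk₁
    rw [H.frameLaplacian_shapeTrace hy (hB y hy)] at hL
    have := (mul_eq_zero.1 hL).resolve_left hf
    have : 0 < k₁ y ^ 2 := by positivity
    nlinarith [sq_nonneg (k₄ y)]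
  · -- space-like gradient
    set W₁ := W₀ ∩ (W ∩ (fun z => 2 * k₁ z + shapeTrace k₁ k₄ z) ⁻¹' {0}ᶜ)
    have hW₁o : IsOpen W₁ := hW₀o.inter (ContinuousOn.isOpen_inter_preimage
      ((continuousOn_const.mul hck).add hcf) H.isOpen hne)
    have hyW : y ∈ W₁ := ⟨⟨⟨hy, hf⟩, hy, ha⟩, hy, hcase⟩
    have H' := H.mono hW₁o fun z hz => hz.2.1
    have hall : ∀ z ∈ W₁, k₄ z = -1 * k₁ z ∧ k₁ z ≠ 0 ∧ dirD (e 0) (shapeTrace k₁ k₄) z = 0 ∧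
        dirD (e 1) (shapeTrace k₁ k₄) z = 0 ∧ dirD (e 2) (shapeTrace k₁ k₄) z = 0 ∧
        dirD (e 3) (shapeTrace k₁ k₄) z ≠ 0 := by
      rintro z ⟨⟨⟨_, hzf⟩, _, hza⟩, hz, hk⟩
      obtain ⟨g0, g1, g2, g3⟩ := H.gradient_system hz (hB z hz)
      have d1 := (mul_eq_zero.1 g1).resolve_left hk
      rw [d1, mul_zero, zero_add] at g2
      have d2 := (mul_eq_zero.1 g2).resolve_left hk
      rw [d2] at g0
      have d0 := (mul_eq_zero.1 (by linear_combination g0 :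
        (2 * k₁ z + shapeTrace k₁ k₄ z) * dirD (e 0) (shapeTrace k₁ k₄) z = 0)).resolve_left hk
      have d3 : dirD (e 3) (shapeTrace k₁ k₄) z ≠ 0 := fun d3 =>
        hza (by fin_cases a <;> assumption)
      have hk4 := (mul_eq_zero.1 g3).resolve_right d3
      -- 2k₄ + f = 3(k₁ + k₄).
      have hk4' : k₄ z = -1 * k₁ z := by simp only [shapeTrace] at hk4; linarith
      refine ⟨hk4', fun h => hzf ?_, d0, d1, d2, d3⟩
      simp [shapeTrace, hk4', h]
    exact (hall y hyW).2.1 (H'.k₁_eq_zero_of_spacelike (fun z hz => (hall z hz).1)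
      (fun z hz => (hall z hz).2.1) (fun z hz => (hall z hz).2.2.1)
      (fun z hz => (hall z hz).2.2.2.1) (fun z hz => (hall z hz).2.2.2.2.1)
      (fun z hz => (hall z hz).2.2.2.2.2) (fun z hz => hB z hz.2.1) hyW)

theorem shapeTrace_eq_zero (H : AdaptedFrame F N e (shapeMatrix k₁ k₄) W)
    (hB : ∀ z ∈ W, frameLaplacian F e (fun z => shapeTrace k₁ k₄ z • N z) z = 0) (hy : y ∈ W) :
    shapeTrace k₁ k₄ y = 0 := by
  by_contra hf
  have hW' : IsOpen (W ∩ shapeTrace k₁ k₄ ⁻¹' {0}ᶜ) :=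
    H.smooth_shapeTrace.continuousOn.isOpen_inter_preimage H.isOpen isOpen_compl_singleton
  have hL := (H.mono hW' Set.inter_subset_left).frameLaplacian_eq_zero_of_gradient
    (u := shapeTrace k₁ k₄) (fun z hz => H.dirD_shapeTrace_eq_zero hB hz.1 hz.2) ⟨hy, hf⟩
  rw [H.frameLaplacian_shapeTrace hy (hB y hy)] at hL
  have h := (mul_eq_zero.1 hL).resolve_left hf
  have h1 : k₁ y = 0 := by nlinarith [sq_nonneg (k₁ y), sq_nonneg (k₄ y)]
  have h4 : k₄ y = 0 := by nlinarith [sq_nonneg (k₁ y), sq_nonneg (k₄ y)]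
  exact hf (by simp [shapeTrace, h1, h4])

/-! ### The bilaplacian of the position vector and the local equivalence -/

theorem laplacian_F (H : AdaptedFrame F N e (shapeMatrix k₁ k₄) W) (hy : y ∈ W) (i : Fin 5) :
    laplacian (inducedMetric F) (fun z => F z i) y = -(shapeTrace k₁ k₄ y • N y) i := by
  rw [H.laplacian_eq (contDiffOn_pi.1 H.smooth_F i) hy, H.frameLaplacian_apply H.smooth_F hy,
    H.frameLaplacian_F hy, sum_gram_secondForm_shapeMatrix]

theorem laplacian_congr {g : R4 → Matrix (Fin 4) (Fin 4) ℝ} {u v : R4 → ℝ}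
    (h : u =ᶠ[nhds y] v) : laplacian g u y = laplacian g v y := by
  have h1 : ∀ j, pd j u =ᶠ[nhds y] pd j v := fun j =>
    (h.fderiv (𝕜 := ℝ)).mono fun z hz => by simp only [pd, hz]
  have h2 : ∀ i j, pd i (pd j u) y = pd i (pd j v) y := fun i j => by
    rw [pd, (h1 j).fderiv_eq, ← pd]
  simp only [laplacian, h2, (h1 _).eq_of_nhds]

/-- The bilaplacian of the position vector. -/
theorem laplacian_laplacian_F (H : AdaptedFrame F N e (shapeMatrix k₁ k₄) W) (hy : y ∈ W)
    (i : Fin 5) :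
    laplacian (inducedMetric F) (laplacian (inducedMetric F) (fun z => F z i)) y =
      -frameLaplacian F e (fun z => -(shapeTrace k₁ k₄ z • N z)) y i := by
  have hs : ContDiffOn ℝ ∞ (fun z => -(shapeTrace k₁ k₄ z • N z)) W :=
    (H.smooth_shapeTrace.smul H.smooth_N).neg
  have : laplacian (inducedMetric F) (fun z => F z i) =ᶠ[nhds y]
      fun z => (-(shapeTrace k₁ k₄ z • N z)) i :=
    Filter.eventually_of_mem (H.isOpen.mem_nhds hy) fun z hz => H.laplacian_F hz i
  rw [laplacian_congr this, H.laplacian_eq (contDiffOn_pi.1 hs i) hy,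
    H.frameLaplacian_apply hs hy]

theorem frameLaplacian_neg {V : Type*} [NormedAddCommGroup V] [NormedSpace ℝ V] (u : R4 → V) :
    frameLaplacian F e (fun z => -u z) y = -frameLaplacian F e u y := by
  have h1 : ∀ b, dirD (e b) (fun z => -u z) = fun z => -dirD (e b) u z :=
    fun b => funext fun z => dirD_neg
  simp only [frameLaplacian, h1, dirD_neg, ← Finset.sum_neg_distrib, ← smul_neg]
  refine Finset.sum_congr rfl fun a _ => Finset.sum_congr rfl fun b _ => ?_
  congr 1
  simp only [smul_neg, Finset.sum_neg_distrib]
  abel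

/-- In an adapted frame, biharmonicity is equivalent to the vanishing of the mean curvature. -/
theorem biharmonic_iff (H : AdaptedFrame F N e (shapeMatrix k₁ k₄) W) :
    (∀ y ∈ W, ∀ i : Fin 5, laplacian (inducedMetric F)
      (laplacian (inducedMetric F) (fun z => F z i)) y = 0) ↔
      ∀ y ∈ W, shapeTrace k₁ k₄ y = 0 := by
  constructor
  · intro h y hy
    refine H.shapeTrace_eq_zero (fun z hz => ?_) hy
    ext i
    have := h z hz i
    rw [H.laplacian_laplacian_F hz, frameLaplacian_neg] at this
    simpa using this
  · intro h y hy i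
    have h0 : ∀ z ∈ W, -(shapeTrace k₁ k₄ z • N z) = 0 := fun z hz => by simp [h z hz]
    have h1 : ∀ b, ∀ z ∈ W, dirD (e b) (fun z => -(shapeTrace k₁ k₄ z • N z)) z = 0 :=
      fun b z hz => dirD_eq_zero_of_const H.isOpen h0 hz
    have h2 : ∀ a b, dirD (e a) (dirD (e b) (fun z => -(shapeTrace k₁ k₄ z • N z))) y = 0 :=
      fun a b => dirD_eq_zero_of_const H.isOpen (h1 b) hy
    rw [H.laplacian_laplacian_F hy]
    simp [frameLaplacian, h2, h1 _ y hy]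

end AdaptedFrame

/-- The trace of the shape operator does not depend on the unit normal, up to a nonzero factor. -/
theorem AdaptedFrame.shapeTrace_eq_zero_of_normal {F N : R4 → E51} {e : Fin 4 → R4 → R4}
    {W : Set R4} {y : R4} {k₁ k₄ : R4 → ℝ} (H : AdaptedFrame F N e (shapeMatrix k₁ k₄) W)
    {N' : R4 → E51} (hN' : ContDiffOn ℝ ∞ N' W) (hu : ∀ z ∈ W, mink (N' z) (N' z) = 1)
    (hn : ∀ z ∈ W, ∀ a, mink (dirD (e a) F z) (N' z) = 0) (hy : y ∈ W)
    (ht : ∑ a, ∑ b, η a b * mink (dirD (e a) N' y) (dirD (e b) F y) = 0) :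
    shapeTrace k₁ k₄ y = 0 := by
  have hc : N' y = mink (N' y) (N y) • N y := by
    conv_lhs => rw [frame_expansion (H.gram y hy) (H.normal y hy) (H.unit y hy) (N' y)]
    simp [mink_comm (N' y) (dirD _ F y), hn y hy]
  have hne : mink (N' y) (N y) ≠ 0 := by
    intro h
    have := hu y hy
    rw [hc, h, zero_smul, mink_zero_left] at this
    exact zero_ne_one this
  have h1 : ∀ a b, mink (dirD (e a) N' y) (dirD (e b) F y) =
      -(mink (N' y) (N y) * secondForm (shapeMatrix k₁ k₄) a b y) := by
    intro a b
    -- Differentiating the orthogonality relation, instead of N' = ⟨N', N⟩ N, avoids differentiating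
    -- the factor ⟨N', N⟩.
    have h := dirD_mink (X := e a) H.isOpen (H.smooth_dirD H.smooth_F b) hN' hy
    rw [dirD_eq_zero_of_const H.isOpen (fun z hz => hn z hz b) hy, mink_comm (dirD (e b) F y),
      hc, mink_smul_right, H.mink_dirD_dirD_F_N hy] at h
    linarith
  have h2 : mink (N' y) (N y) * ∑ a, ∑ b, η a b * secondForm (shapeMatrix k₁ k₄) a b y = 0 := by
    rw [← neg_eq_zero, ← ht]
    simp only [h1, Finset.mul_sum, ← Finset.sum_neg_distrib]
    refine Finset.sum_congr rfl fun _ _ => Finset.sum_congr rfl fun _ _ => by ring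
  rw [sum_gram_secondForm_shapeMatrix] at h2
  exact (mul_eq_zero.1 h2).resolve_left hne

/-! ### From the manifold to a chart -/

variable {M : Type*} [TopologicalSpace M] [ChartedSpace R4 M]

/-- The coordinate expression of a frame field in a chart. -/
noncomputable def chartFrame (φ : OpenPartialHomeomorph M R4)
    (e : Fin 4 → (p : M) → TangentSpace (𝓡 4) p) (a : Fin 4) (z : R4) : R4 :=
  mfderiv (𝓡 4) (𝓡 4) φ (φ.symm z) (e a (φ.symm z))

/-- The differential of an `E51`-valued map on the manifold. -/
noncomputable def diffMap (f : M → E51) (p : M) : TangentSpace (𝓡 4) p →ₗ[ℝ] E51 :=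
  (mfderiv (𝓡 4) 𝓘(ℝ, E51) f p).toLinearMap

theorem exists_chart_symm_eq (p : M) :
    ∃ φ ∈ atlas R4 M, ∃ z ∈ φ.target, φ.symm z = p :=
  ⟨chartAt R4 p, chart_mem_atlas _ _, chartAt R4 p p, mem_chart_target _ _,
    (chartAt R4 p).left_inv (mem_chart_source _ _)⟩

theorem mdifferentiableAt_of_contMDiffOn {f : M → E51} {U : Set M} (hU : IsOpen U)
    (hf : ContMDiffOn (𝓡 4) 𝓘(ℝ, E51) ∞ f U) {p : M} (hp : p ∈ U) :
    MDifferentiableAt (𝓡 4) 𝓘(ℝ, E51) f p :=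
  (hf.contMDiffAt (hU.mem_nhds hp)).mdifferentiableAt (by simp)

variable [IsManifold (𝓡 4) ∞ M] {φ : OpenPartialHomeomorph M R4}

theorem fderiv_comp_chart_symm (hφ : φ ∈ atlas R4 M) {f : M → E51} {z : R4} (hz : z ∈ φ.target)
    (hf : MDifferentiableAt (𝓡 4) 𝓘(ℝ, E51) f (φ.symm z)) (v : TangentSpace (𝓡 4) (φ.symm z)) :
    fderiv ℝ (f ∘ φ.symm) z (mfderiv (𝓡 4) (𝓡 4) φ (φ.symm z) v) =
      diffMap f (φ.symm z) v := by
  have : IsManifold (𝓡 4) 1 M := IsManifold.of_le (n := ∞) (by simp)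
  have hp := φ.map_target hz
  have hG : MDifferentiableAt (𝓡 4) 𝓘(ℝ, E51) (f ∘ φ.symm) (φ (φ.symm z)) := by
    rw [φ.right_inv hz]
    exact hf.comp z (mdifferentiableAt_atlas_symm hφ hz)
  have hev : f =ᶠ[nhds (φ.symm z)] (f ∘ φ.symm) ∘ φ :=
    Filter.eventually_of_mem (φ.open_source.mem_nhds hp) fun q hq => by simp [φ.left_inv hq]
  rw [diffMap, hev.mfderiv_eq, mfderiv_comp _ hG (mdifferentiableAt_atlas hφ hp), mfderiv_eq_fderiv]
  simp only [φ.right_inv hz]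
  rfl

theorem contDiffOn_comp_chart_symm {V : Type*} [NormedAddCommGroup V] [NormedSpace ℝ V]
    (hφ : φ ∈ atlas R4 M) {f : M → V} {U : Set M}
    (hf : ContMDiffOn (𝓡 4) 𝓘(ℝ, V) ∞ f U) :
    ContDiffOn ℝ ∞ (f ∘ φ.symm) (φ.target ∩ φ.symm ⁻¹' U) := by
  have h := contMDiffOn_symm_of_mem_maximalAtlas (I := 𝓡 4) (n := ∞)
    (IsManifold.subset_maximalAtlas hφ)
  exact contMDiffOn_iff_contDiffOn.1 (hf.comp' h)

/-- The section z ↦ (z, `chartFrame φ e a z`) is the tangent map of φ composed with the smooth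
section e a and with φ⁻¹. -/
theorem contDiffOn_chartFrame (hφ : φ ∈ atlas R4 M) {e : Fin 4 → (p : M) → TangentSpace (𝓡 4) p}
    {U : Set M} (a : Fin 4) (he : ContMDiffOn (𝓡 4) (𝓡 4).tangent ∞
      (fun p => (⟨p, e a p⟩ : TangentBundle (𝓡 4) M)) U) :
    ContDiffOn ℝ ∞ (chartFrame φ e a) (φ.target ∩ φ.symm ⁻¹' U) := by
  have h := contMDiffOn_symm_of_mem_maximalAtlas (I := 𝓡 4) (n := ∞)
    (IsManifold.subset_maximalAtlas hφ)
  have h' := contMDiffOn_of_mem_maximalAtlas (I := 𝓡 4) (n := ∞)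
    (IsManifold.subset_maximalAtlas hφ)
  have ht := h'.contMDiffOn_tangentMapWithin (m := ∞) (by simp) φ.open_source.uniqueMDiffOn
  have hc := ht.comp' (he.comp' h)
  refine contMDiffOn_vectorSpace_iff_contDiffOn.1 ((hc.mono ?_).congr ?_)
  · rintro z ⟨hz, hzU⟩
    exact ⟨⟨hz, hzU⟩, φ.map_target hz⟩
  · rintro z ⟨hz, hzU⟩
    have hm : mfderivWithin (𝓡 4) (𝓡 4) φ φ.source (φ.symm z) = mfderiv (𝓡 4) (𝓡 4) φ (φ.symm z) :=
      mfderivWithin_of_isOpen φ.open_source (φ.map_target hz)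
    simp only [Function.comp, tangentMapWithin, hm]
    exact Bundle.TotalSpace.ext (φ.right_inv hz).symm (HEq.refl (chartFrame φ e a z))

/-- The derivative of a unit normal field is tangent. -/
theorem mink_diffMap_unitNormal {x N : M → E51} {U : Set M} (hU : IsOpen U)
    (hN : IsUnitNormalOn x N U) {p : M} (hp : p ∈ U) (v : TangentSpace (𝓡 4) p) :
    mink (diffMap N p v) (N p) = 0 := by
  obtain ⟨φ, hφ, z, hz, rfl⟩ := exists_chart_symm_eq p
  have hW : IsOpen (φ.target ∩ φ.symm ⁻¹' U) := φ.isOpen_inter_preimage_symm hU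
  have hs := contDiffOn_comp_chart_symm hφ hN.smooth
  set t : R4 := mfderiv (𝓡 4) (𝓡 4) φ (φ.symm z) v
  have h := dirD_mink (X := fun _ => t) hW hs hs ⟨hz, hp⟩
  have h0 : dirD (fun _ => t) (fun y => mink ((N ∘ φ.symm) y) ((N ∘ φ.symm) y)) z = 0 :=
    dirD_eq_zero_of_const hW (fun y hy => hN.unit _ hy.2) ⟨hz, hp⟩
  have h1 : dirD (fun _ => t) (N ∘ φ.symm) z = diffMap N (φ.symm z) v :=
    fderiv_comp_chart_symm hφ hz (mdifferentiableAt_of_contMDiffOn hU hN.smooth hp) v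
  rw [h0, h1, mink_comm ((N ∘ φ.symm) z)] at h
  simp only [Function.comp] at h
  linarith

/-- At a point carrying a pseudo-orthonormal frame, `dx (S v) = -dN v`. -/
theorem diffMap_shapeOperator {x N : M → E51} (hx : IsLorentzianHypersurface x) {U : Set M}
    (hU : IsOpen U) (hN : IsUnitNormalOn x N U) {p : M} (hp : p ∈ U)
    {e : Fin 4 → TangentSpace (𝓡 4) p}
    (he : ∀ i j, firstForm x p (e i) (e j) = η i j) (v : TangentSpace (𝓡 4) p) :
    diffMap x p (shapeOperator x N p v) = -diffMap N p v := by
  set w : E51 := -diffMap N p v with hw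
  have hwN : mink w (N p) = 0 := by
    rw [hw, mink_neg_left, mink_diffMap_unitNormal hU hN hp, neg_zero]
  -- The left inverse is controlled only on the range of dx; w lies there because it has no normal
  -- component in the frame expansion.
  obtain ⟨t, ht⟩ : ∃ t, diffMap x p t = w := by
    refine ⟨∑ c, ∑ d, (η c d * mink w (diffMap x p (e d))) • e c, ?_⟩
    have h := frame_expansion (E := fun i => diffMap x p (e i)) he
      (fun i => hN.normal p hp (e i)) (hN.unit p hp) w
    rw [hwN, zero_smul, add_zero] at h
    simp only [map_sum, map_smul]
    exact h.symm
  have hS : shapeOperator x N p v = t := by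
    have : shapeOperator x N p v = (diffMap x p).leftInverse w := rfl
    rw [this, ← ht]
    exact LinearMap.leftInverse_apply_of_inj (LinearMap.ker_eq_bot.2 (hx.immersion p)) t
  rw [hS]
  exact ht

theorem trace_shapeOperator {x N : M → E51} (hx : IsLorentzianHypersurface x) {U : Set M}
    (hU : IsOpen U) (hN : IsUnitNormalOn x N U) {p : M} (hp : p ∈ U)
    {e : Fin 4 → TangentSpace (𝓡 4) p} (he : ∀ i j, firstForm x p (e i) (e j) = η i j) :
    LinearMap.trace ℝ (TangentSpace (𝓡 4) p) (shapeOperator x N p) =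
      -∑ a, ∑ b, η a b * mink (diffMap N p (e a)) (diffMap x p (e b)) := by
  rw [trace_eq_sum_gram (L := diffMap x p) (finrank_euclideanSpace_fin (𝕜 := ℝ) (n := 4)) he]
  simp only [diffMap_shapeOperator hx hU hN hp he, mink_neg_left, mul_neg, Finset.sum_neg_distrib]

variable {x N : M → E51} {U : Set M} {e : Fin 4 → (p : M) → TangentSpace (𝓡 4) p} {k₁ k₄ : M → ℝ}

theorem dirD_chartFrame (hφ : φ ∈ atlas R4 M) {f : M → E51} (hU : IsOpen U)
    (hf : ContMDiffOn (𝓡 4) 𝓘(ℝ, E51) ∞ f U) {z : R4} (hz : z ∈ φ.target ∩ φ.symm ⁻¹' U)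
    (a : Fin 4) : dirD (chartFrame φ e a) (f ∘ φ.symm) z =
      diffMap f (φ.symm z) (e a (φ.symm z)) :=
  fderiv_comp_chart_symm hφ hz.1 (mdifferentiableAt_of_contMDiffOn hU hf hz.2) _

/-- The coordinate expression of the given data is an adapted frame. -/
theorem adaptedFrame_of_chart (hx : IsLorentzianHypersurface x) (hU : IsOpen U)
    (hN : IsUnitNormalOn x N U) (he : IsPseudoOrthonormalFrameOn x e U)
    (hk₁ : ContMDiffOn (𝓡 4) 𝓘(ℝ, ℝ) ∞ k₁ U) (hk₄ : ContMDiffOn (𝓡 4) 𝓘(ℝ, ℝ) ∞ k₄ U)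
    (hS : ∀ p ∈ U,
      shapeOperator x N p (e 0 p) = k₁ p • e 0 p - e 2 p ∧
      shapeOperator x N p (e 1 p) = k₁ p • e 1 p ∧
      shapeOperator x N p (e 2 p) = e 1 p + k₁ p • e 2 p ∧
      shapeOperator x N p (e 3 p) = k₄ p • e 3 p)
    (hφ : φ ∈ atlas R4 M) :
    AdaptedFrame (x ∘ φ.symm) (N ∘ φ.symm) (chartFrame φ e)
      (shapeMatrix (k₁ ∘ φ.symm) (k₄ ∘ φ.symm)) (φ.target ∩ φ.symm ⁻¹' U) where
  isOpen := φ.isOpen_inter_preimage_symm hU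
  smooth_F := contDiffOn_comp_chart_symm hφ hx.smooth.contMDiffOn
  smooth_N := contDiffOn_comp_chart_symm hφ hN.smooth
  smooth_e a := contDiffOn_chartFrame hφ a (he.smooth a)
  smooth_S a b := by
    have h1 := contDiffOn_comp_chart_symm hφ hk₁
    have h4 := contDiffOn_comp_chart_symm hφ hk₄
    fin_cases a <;> fin_cases b <;> first | exact contDiffOn_const | exact h1 | exact h4
  gram z hz a b := by
    rw [dirD_chartFrame hφ hU hx.smooth.contMDiffOn hz,
      dirD_chartFrame hφ hU hx.smooth.contMDiffOn hz]
    exact he.gram _ hz.2 a b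
  unit z hz := hN.unit _ hz.2
  normal z hz a := by
    rw [dirD_chartFrame hφ hU hx.smooth.contMDiffOn hz]
    exact hN.normal _ hz.2 _
  weingarten z hz a := by
    have h := diffMap_shapeOperator hx hU hN hz.2 (he.gram _ hz.2) (e a (φ.symm z))
    obtain ⟨s0, s1, s2, s3⟩ := hS _ hz.2
    simp only [dirD_chartFrame hφ hU hx.smooth.contMDiffOn hz, dirD_chartFrame hφ hU hN.smooth hz]
    rw [← neg_eq_iff_eq_neg.2 h]
    congr 1
    fin_cases a <;> simp [Fin.sum_univ_four, shapeMatrix, s0, s1, s2, s3, sub_eq_add_neg]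

end LorentzHypersurface

open LorentzHypersurface in
theorem theorem3p3 {M : Type*} [TopologicalSpace M] [ChartedSpace R4 M] [IsManifold (𝓡 4) ∞ M]
    (x : M → E51) (hx : IsLorentzianHypersurface x) (hS : HasCaseIIShapeOperator x) :
    IsBiharmonic x ↔ IsMinimal x := by
  constructor
  · intro hB p
    obtain ⟨U, N, e, k₁, k₄, hU, hp, hN, he, hk₁, hk₄, hs⟩ := hS p
    refine ⟨U, N, hU, hp, hN, ?_⟩
    obtain ⟨φ, hφ, z, hz, rfl⟩ := exists_chart_symm_eq p
    have H := adaptedFrame_of_chart hx hU hN he hk₁ hk₄ hs hφ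
    have h0 := H.biharmonic_iff.1 (fun y hy i => hB φ hφ y hy.1 i) z ⟨hz, hp⟩
    rw [trace_shapeOperator hx hU hN hp (he.gram _ hp), ← h0, ← sum_gram_secondForm_shapeMatrix]
    have hb : ∀ a b, mink (diffMap N (φ.symm z) (e a (φ.symm z)))
        (diffMap x (φ.symm z) (e b (φ.symm z))) =
        -secondForm (shapeMatrix (k₁ ∘ φ.symm) (k₄ ∘ φ.symm)) a b z := fun a b => by
      rw [← dirD_chartFrame hφ hU hN.smooth ⟨hz, hp⟩,
        ← dirD_chartFrame hφ hU hx.smooth.contMDiffOn ⟨hz, hp⟩]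
      exact H.mink_dirD_N ⟨hz, hp⟩ a b
    simp only [hb, mul_neg, Finset.sum_neg_distrib, neg_neg]
  · intro hm φ hφ y hy i
    obtain ⟨U, N, e, k₁, k₄, hU, hp, hN, he, hk₁, hk₄, hs⟩ := hS (φ.symm y)
    have H := adaptedFrame_of_chart hx hU hN he hk₁ hk₄ hs hφ
    refine H.biharmonic_iff.2 (fun z hz => ?_) y ⟨hy, hp⟩ i
    -- Minimality comes with its own normal N', a priori unrelated to N, and the trace vanishes only
    -- at this one point; the two normals are compared on U ∩ U'.
    obtain ⟨U', N', hU', hp', hN', ht⟩ := hm (φ.symm z)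
    have hW' : IsOpen (φ.target ∩ φ.symm ⁻¹' (U ∩ U')) :=
      φ.isOpen_inter_preimage_symm (hU.inter hU')
    have H' := H.mono hW' fun q hq => ⟨hq.1, hq.2.1⟩
    refine H'.shapeTrace_eq_zero_of_normal (N' := N' ∘ φ.symm)
      ((contDiffOn_comp_chart_symm hφ hN'.smooth).mono fun q hq => ⟨hq.1, hq.2.2⟩)
      (fun q hq => hN'.unit _ hq.2.2) (fun q hq a => ?_) ⟨hz.1, hz.2, hp'⟩ ?_
    · rw [dirD_chartFrame hφ hU hx.smooth.contMDiffOn ⟨hq.1, hq.2.1⟩]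
      exact hN'.normal _ hq.2.2 _
    · simp only [dirD_chartFrame hφ hU hx.smooth.contMDiffOn hz,
        dirD_chartFrame hφ hU' hN'.smooth ⟨hz.1, hp'⟩]
      rwa [trace_shapeOperator hx hU' hN' hp' (he.gram _ hz.2), neg_eq_zero] at ht
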